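/- **Setting.** Let $M\in\mathbb R^{m\times n}$ with singular values $\sigma_1\ge\sigma_2\ge\cdots$ ($\sigma_j:=0$ for $j>\min\{m,n\}$), let $1\le r\le\min\{m,n\}$, and let $M=U\Sigma V^T$ be an SVD with $U\in\mathbb R^{m\times m}$ and $V\in\mathbb R^{n\times n}$ orthogonal. Let $U^{(r)}$, $V^{(r)}$ consist of the first $r$ columns of $U$, $V$, and let $M_r=U^{(r)}\operatorname{diag}(\sigma_1,\dots,\sigma_r)(V^{(r)})^T$. For subspaces $E,F$ of $\mathbb R^m$ let $\operatorname{dist}(E,F)=\|G_\perp^TH\|=\|H_\perp^TG\|$ (spectral norm), where the columns of $G,G_\perp,H,H_\perp$ are orthonormal bases of $E,E^\perp,F,F^\perp$; if $\dim E\ne\dim F$, put $\operatorname{dist}(E,F)=1$. For matrices $A,A'$ with $m$ rows, $\operatorname{dist}(A,A')$ is the distance of their column spans. $X^+$ is the Moore–Penrose pseudo-inverse. The rank-$r$ row (column) leverage scores of a matrix are the squared Euclidean norms of the rows of $U^{(r)}$ (of $V^{(r)}$) in an SVD of that matrix. **Sampling.** Let $\epsilon,\xi>0$. A sampling distribution directed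 by leverage scores $\gamma_1,\dots,\gamma_d$ with parameter $\beta\in(0,1]$ is a probability distribution $p$ on $\{1,\dots,d\}$ with $p_j>0$ and $p_j\ge\beta\gamma_j/r$ for all $j$. Given $p$ and $\beta$, put $l=\lceil 1296\,\beta^{-1}r^2\epsilon^{-2}\xi^{-4}\rceil$, draw $i_1,\dots,i_l$ independently from $p$, and let $S\in\mathbb R^{d\times l}$ have $S_{i,t}=1$ if $i=i_t$ and $S_{i,t}=0$ otherwise, and $D=\operatorname{diag}\big(1/\sqrt{l\,p_{i_t}}\big)_{t=1}^l$. **Algorithm.** Start from $A_0\in\mathbb R^{m\times r}$. For $t=0,1,\dots,\tau-1$: (1) choose $\beta\in(0,1]$ and a sampling distribution on $\{1,\dots,m\}$ directed by the rank-$r$ row leverage scores of $A_t$ with parameter $\beta$, draw $S,D$ from it, and put $B_t=(D^TS^TA_t)^+D^TS^TM$; (2) choose $\beta\in(0,1]$ and a sampling distribution on $\{1,\dots,n\}$ directed by the rank-$r$ column leverage scores of $B_t$ with parameter $\beta$, draw fresh $S,D$ from it, and put $A_{t+1}=MSD(B_tSD)^+$. The output is $A=A_\tau$. The choices of $\beta$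 and of the sampling distributions are arbitrary subject to these conditions, and may depend on the outcomes of the earlier sampling steps. **Theorem.** Suppose that $0<\sigma_{r+1}<\sigma_r$, $\sigma_{r+1}/\sigma_r\le\frac12$, $\theta=\|M-M_r\|_F/\sigma_{r+1}$ and $\operatorname{dist}(A_0,U^{(r)})\le\frac12$. Let $0<\xi<1$, $0<\epsilon\le\frac1{8\theta}$ and $\tau=\left\lceil\frac12\log_{0.87}(8\theta\epsilon)\right\rceil$. Then, for every admissible sequence of choices, the output $A$ of the algorithm after $\tau$ iterations satisfies $$\operatorname{dist}(A,U^{(r)})\le4\theta\epsilon$$ with probability at least $1-2\tau\xi$. -/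

import Mathlib

open scoped Matrix

namespace LeverageRefinement

noncomputable section

/-- The `j`-th largest singular value of `M`, counted from `1` and with multiplicity;
it is `0` for `j > min m n`. -/
def singularValue {m n : ℕ} (M : Matrix (Fin m) (Fin n) ℝ) (j : ℕ) : ℝ :=
  (Matrix.toEuclideanLin M).singularValues (j - 1)

open scoped Matrix.Norms.Frobenius in
/-- The Frobenius norm of a matrix. -/
def frobeniusNorm {m n : ℕ} (M : Matrix (Fin m) (Fin n) ℝ) : ℝ := ‖M‖

/-- `M = U Σ Vᵀ` is a (full) singular value decomposition of `M`: the matrices `U` and `V` are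
orthogonal and `Σ` carries the singular values of `M` in non-increasing order on its diagonal. -/
def IsSVD {m n : ℕ} (M : Matrix (Fin m) (Fin n) ℝ)
    (U : Matrix (Fin m) (Fin m) ℝ) (V : Matrix (Fin n) (Fin n) ℝ) : Prop :=
  U ∈ Matrix.orthogonalGroup (Fin m) ℝ ∧ V ∈ Matrix.orthogonalGroup (Fin n) ℝ ∧
    M = U * Matrix.of (fun (i : Fin m) (j : Fin n) =>
      if (i : ℕ) = (j : ℕ) then singularValue M ((i : ℕ) + 1) else 0) * Vᵀ

/-- The matrix formed by the first `r` columns of a square matrix. Applied to the factors `U` and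
`V` of an SVD it gives `U^{(r)}` and `V^{(r)}`. -/
def firstCols {d r : ℕ} (h : r ≤ d) (U : Matrix (Fin d) (Fin d) ℝ) :
    Matrix (Fin d) (Fin r) ℝ :=
  U.submatrix id (Fin.castLE h)

/-- The `r`-truncation `M_r = U^{(r)} Σ^{(r)} (V^{(r)})ᵀ` of `M`, for an SVD of `M` with orthogonal
factors `U` and `V`. -/
def truncation {m n r : ℕ} (hm : r ≤ m) (hn : r ≤ n) (M : Matrix (Fin m) (Fin n) ℝ)
    (U : Matrix (Fin m) (Fin m) ℝ) (V : Matrix (Fin n) (Fin n) ℝ) :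
    Matrix (Fin m) (Fin n) ℝ :=
  firstCols hm U * Matrix.diagonal (fun j : Fin r => singularValue M ((j : ℕ) + 1)) *
    (firstCols hn V)ᵀ

/-- The column span of a matrix. -/
def colSpan {m n : ℕ} (A : Matrix (Fin m) (Fin n) ℝ) :
    Submodule ℝ (EuclideanSpace ℝ (Fin m)) :=
  LinearMap.range (Matrix.toEuclideanLin A)

/-- The principal angle distance of two subspaces. If the columns of `G`, `G_⊥`, `H`, `H_⊥` are
orthonormal bases of `E`, `Eᗮ`, `F`, `Fᗮ`, then the two norms below are the spectral norms of
`G_⊥ᵀ H` and `H_⊥ᵀ G`. They are equal if `E` and `F` have the same dimension; otherwise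
the larger one is `1`. -/
def principalAngleDist {d : ℕ} (E F : Submodule ℝ (EuclideanSpace ℝ (Fin d))) : ℝ :=
  max ‖(Eᗮ.orthogonalProjectionOnto).comp F.subtypeL‖ ‖(Fᗮ.orthogonalProjectionOnto).comp E.subtypeL‖

/-- The Moore-Penrose pseudo-inverse `A⁺ = (AᵀA)⁺ Aᵀ`, where `(AᵀA)⁺` inverts the nonzero
eigenvalues of `AᵀA` (recall that `0⁻¹ = 0`). See `pinv_spec` for the Penrose equations. -/
def pinv {k l : ℕ} (A : Matrix (Fin k) (Fin l) ℝ) : Matrix (Fin l) (Fin k) ℝ :=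
  let hA : (Aᵀ * A).IsHermitian := Matrix.isHermitian_conjTranspose_mul_self A
  (hA.eigenvectorUnitary : Matrix (Fin l) (Fin l) ℝ) *
    Matrix.diagonal (fun i => (hA.eigenvalues i)⁻¹) *
    (hA.eigenvectorUnitary : Matrix (Fin l) (Fin l) ℝ)ᵀ * Aᵀ

/-- `pinv A` satisfies the four Penrose equations, which determine it uniquely. -/
theorem pinv_spec {k l : ℕ} (A : Matrix (Fin k) (Fin l) ℝ) :
    A * pinv A * A = A ∧ pinv A * A * pinv A = pinv A ∧
      (A * pinv A)ᵀ = A * pinv A ∧ (pinv A * A)ᵀ = pinv A * A := by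
  have hA : (Aᵀ * A).IsHermitian := Matrix.isHermitian_conjTranspose_mul_self A
  obtain ⟨Q, hQ⟩ : ∃ Q : Matrix (Fin l) (Fin l) ℝ, Q = hA.eigenvectorUnitary := ⟨_, rfl⟩
  obtain ⟨D, hD⟩ : ∃ D : Fin l → ℝ, D = hA.eigenvalues := ⟨_, rfl⟩
  have hX : pinv A = Q * Matrix.diagonal (fun i => (D i)⁻¹) * Qᵀ * Aᵀ := by
    rw [hQ, hD]; rfl
  have hG : Aᵀ * A = Q * Matrix.diagonal D * Qᵀ := by
    have := hA.spectral_theorem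
    rw [Unitary.conjStarAlgAut_apply] at this
    rw [hQ, hD]
    exact this
  have hQ1 : Qᵀ * Q = 1 := by
    rw [hQ]; exact Unitary.coe_star_mul_self hA.eigenvectorUnitary
  obtain ⟨N, hN⟩ : ∃ N, N = Q * Matrix.diagonal (fun i => (D i)⁻¹) * Qᵀ := ⟨_, rfl⟩
  rw [← hN] at hX
  have hNt : Nᵀ = N := by
    simp [hN, Matrix.transpose_mul, Matrix.mul_assoc]
  have hprod (a b : Fin l → ℝ) : (Q * Matrix.diagonal a * Qᵀ) * (Q * Matrix.diagonal b * Qᵀ) =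
      Q * Matrix.diagonal (fun i => a i * b i) * Qᵀ := by
    calc _ = Q * Matrix.diagonal a * (Qᵀ * Q) * Matrix.diagonal b * Qᵀ := by
          simp only [Matrix.mul_assoc]
      _ = _ := by
          rw [hQ1, Matrix.mul_one, Matrix.mul_assoc Q, Matrix.diagonal_mul_diagonal]
  have hNGN : N * (Aᵀ * A) * N = N := by
    rw [hG, hN, hprod, hprod]
    congr 3; ext i; by_cases h : D i = 0 <;> simp [h]
  have hGNG : (Aᵀ * A) * N * (Aᵀ * A) = Aᵀ * A := by
    rw [hG, hN, hprod, hprod]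
    congr 3; ext i; by_cases h : D i = 0 <;> simp [h]
  have hXA : (pinv A * A)ᵀ = pinv A * A := by
    rw [hX, Matrix.mul_assoc, hG, hN, hprod]
    simp [Matrix.transpose_mul, Matrix.mul_assoc]
  refine ⟨?_, ?_, ?_, hXA⟩
  · have h0 : (A * (pinv A * A) - A)ᵀ * (A * (pinv A * A) - A) = 0 := by
      have h1 : Aᵀ * (A * (pinv A * A) - A) = 0 := by
        rw [Matrix.mul_sub, hX]
        simp only [Matrix.mul_assoc] at hGNG ⊢
        rw [hGNG, sub_self]
      rw [Matrix.transpose_sub, Matrix.transpose_mul, hXA, Matrix.sub_mul, Matrix.mul_assoc, h1]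
      simp
    have h2 := Matrix.conjTranspose_mul_self_eq_zero.mp
      (show (A * (pinv A * A) - A)ᴴ * (A * (pinv A * A) - A) = 0 from h0)
    rw [Matrix.mul_assoc]
    exact sub_eq_zero.mp h2
  · rw [hX]
    simp only [← Matrix.mul_assoc] at hNGN ⊢
    rw [hNGN]
  · rw [hX]
    simp [Matrix.transpose_mul, hNt, Matrix.mul_assoc]

/-- `γ` is the vector of rank-`r` row leverage scores of `A`: the squared Euclidean norms of
the rows of `U^{(r)}` for an SVD of `A`. -/
def IsRowLeverage {m n r : ℕ} (h : r ≤ m) (A : Matrix (Fin m) (Fin n) ℝ) (γ : Fin m → ℝ) : Prop :=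
  ∃ U V, IsSVD A U V ∧ ∀ i, γ i = ∑ j : Fin r, firstCols h U i j ^ 2

/-- `γ` is the vector of rank-`r` column leverage scores of `B`: the squared Euclidean norms of
the rows of `V^{(r)}` for an SVD of `B`. -/
def IsColLeverage {m n r : ℕ} (h : r ≤ n) (B : Matrix (Fin m) (Fin n) ℝ) (γ : Fin n → ℝ) : Prop :=
  ∃ U V, IsSVD B U V ∧ ∀ i, γ i = ∑ j : Fin r, firstCols h V i j ^ 2

/-- `p` is a sampling distribution directed by the rank-`r` leverage scores `γ` with
parameter `β`: `0 < β ≤ 1`, `p_j > 0` and `p_j ≥ β γ_j / r` for all `j` (and `∑ p_j = 1`). -/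
def IsSamplingDist {d : ℕ} (r : ℕ) (β : ℝ) (γ : Fin d → ℝ) (p : PMF (Fin d)) : Prop :=
  0 < β ∧ β ≤ 1 ∧ ∀ j, 0 < (p j).toReal ∧ β * γ j / r ≤ (p j).toReal

/-- The number `l = 1296 β⁻¹ r² ε⁻² ξ⁻⁴` of samples, rounded up to an integer. -/
def sampleSize (r : ℕ) (ε ξ β : ℝ) : ℕ :=
  ⌈1296 * β⁻¹ * (r : ℝ) ^ 2 * (ε ^ 2)⁻¹ * (ξ ^ 4)⁻¹⌉₊

/-- The law of `l` indices `i_1, …, i_l` drawn independently from the distribution `p`. -/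
def iidSample {d : ℕ} (p : PMF (Fin d)) (l : ℕ) : PMF (Fin l → Fin d) :=
  PMF.ofFintype (fun ω => ∏ t, p (ω t)) (by
    have h : ∑ j, p j = 1 := by rw [← tsum_fintype (L := .unconditional _)]; exact p.tsum_coe
    rw [← Fintype.piFinset_univ, ← Finset.prod_univ_sum]
    simp [h])

/-- The `d × l` sampling matrix `S` of the drawn indices: `s_{i,t} = 1` if `i = i_t` and
`s_{i,t} = 0` otherwise. -/
def samplingMatrix {d l : ℕ} (ω : Fin l → Fin d) : Matrix (Fin d) (Fin l) ℝ :=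
  Matrix.of fun i t => if i = ω t then 1 else 0

/-- The `l × l` re-scaling matrix `D = diag(1 / √(l p_{i_t}))` of the drawn indices. -/
def rescalingMatrix {d l : ℕ} (p : PMF (Fin d)) (ω : Fin l → Fin d) : Matrix (Fin l) (Fin l) ℝ :=
  Matrix.diagonal fun t => 1 / Real.sqrt ((l : ℝ) * (p (ω t)).toReal)

/-- The matrix `B = (Dᵀ Sᵀ A)⁺ Dᵀ Sᵀ M`. -/
def updateB {m n r l : ℕ} (M : Matrix (Fin m) (Fin n) ℝ) (A : Matrix (Fin m) (Fin r) ℝ)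
    (p : PMF (Fin m)) (ω : Fin l → Fin m) : Matrix (Fin r) (Fin n) ℝ :=
  let S := samplingMatrix ω
  let D := rescalingMatrix p ω
  pinv (Dᵀ * Sᵀ * A) * (Dᵀ * Sᵀ * M)

/-- The matrix `A = M S D (B S D)⁺`. -/
def updateA {m n r l : ℕ} (M : Matrix (Fin m) (Fin n) ℝ) (B : Matrix (Fin r) (Fin n) ℝ)
    (q : PMF (Fin n)) (ω : Fin l → Fin n) : Matrix (Fin m) (Fin r) ℝ :=
  let S := samplingMatrix ω
  let D := rescalingMatrix q ω
  M * S * D * pinv (B * S * D)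

/-- `IsOutputLaw hm hn M ε ξ τ A μ`: `μ` is a possible probability distribution of the output of
`τ` iterations of the alternating refinement of `M` directed by leverage scores and
started at `A`. The algorithm leaves open which admissible `β` and sampling distribution it uses
at each sampling step; every choice is allowed here, and it may depend on all the outcomes of the
preceding sampling steps.

One iteration started at `A`: choose `β` and a distribution `p` directed by the row
leverage scores of `A`, draw indices `ω` and put `B = updateB M A p ω`; then choose `β'`
and a distribution `q` directed by the column leverage scores of `B`, draw fresh indices `ω'`, and
replace `A` by `updateA M B q ω'`. -/
inductive IsOutputLaw {m n r : ℕ} (hm : r ≤ m) (hn : r ≤ n) (M : Matrix (Fin m) (Fin n) ℝ)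
    (ε ξ : ℝ) : ℕ → Matrix (Fin m) (Fin r) ℝ → PMF (Matrix (Fin m) (Fin r) ℝ) → Prop
  | zero (A : Matrix (Fin m) (Fin r) ℝ) : IsOutputLaw hm hn M ε ξ 0 A (PMF.pure A)
  | succ (k : ℕ) (A : Matrix (Fin m) (Fin r) ℝ)
      (γ : Fin m → ℝ) (β : ℝ) (p : PMF (Fin m))
      (hγ : IsRowLeverage hm A γ) (hp : IsSamplingDist r β γ p)
      (γ' : (Fin (sampleSize r ε ξ β) → Fin m) → Fin n → ℝ)
      (β' : (Fin (sampleSize r ε ξ β) → Fin m) → ℝ)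
      (q : (Fin (sampleSize r ε ξ β) → Fin m) → PMF (Fin n))
      (hγ' : ∀ ω, IsColLeverage hn (updateB M A p ω) (γ' ω))
      (hq : ∀ ω, IsSamplingDist r (β' ω) (γ' ω) (q ω))
      (ν : (ω : Fin (sampleSize r ε ξ β) → Fin m) →
        (Fin (sampleSize r ε ξ (β' ω)) → Fin n) → PMF (Matrix (Fin m) (Fin r) ℝ))
      (hν : ∀ ω ω', IsOutputLaw hm hn M ε ξ k
        (updateA M (updateB M A p ω) (q ω) ω') (ν ω ω')) :
      IsOutputLaw hm hn M ε ξ (k + 1) A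
        ((iidSample p (sampleSize r ε ξ β)).bind fun ω =>
          (iidSample (q ω) (sampleSize r ε ξ (β' ω))).bind fun ω' => ν ω ω')

end

end LeverageRefinement

/-! Write the current iterate as `Q * R` with `Q` orthonormal, the leverage scores being the squared
row norms of `Q`. Let `P`, `P'` be the leading singular bases, `s` the retained singular values, `K`
the residual of `M`, and `T` the sketch.

If the sketched Gram matrix `G` of `Q` and `R` are invertible, the least squares solution is `R⁻¹ *
(N * M)`, where `N = G⁻¹ * ((T * Q)ᵀ * T)` is a left inverse of `Q`. Hence `N * Y` is `Qᵀ * Y` plus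
the sampling error of the part of `Y` orthogonal to `Q`. Normalizing the row space of `N * M` by `N
* P` and `diagonal s` makes it a graph over `P'`, with deviation of norm about `‖N * K‖ / σ_r`.
Since `Pᵀ * K = 0`, the exact part `Qᵀ * K` is at most `δ * σ_{r+1}` when the current distance is at
most `δ`. The gap ratio 1/2 thus gives a contraction (`principalAngleDist_sketched_lstsq_le`).

The sampling errors are controlled in Frobenius norm, whose mean square is a sum of variances of
independent importance sampling estimates. Leverage scores bound it by `r / (β l)` times the squared
Frobenius norm of the sampled factor (`expectation_froSq_sketch_le`), and Markov's inequality gives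
failure probability at most `ξ` per half-step (`toOuterMeasure_updateB_le`). The error from `K` has
size about `ε * θ * σ_{r+1}` regardless of `δ`, so contraction only works down to the floor `4 * θ *
ε`.

The column half-step is the row half-step for `Mᵀ` (`transpose_updateA`). A union bound over the
`2τ` half-steps, conditional on the history, finishes the proof (`IsOutputLaw.toOuterMeasure_le`).
-/

namespace LeverageRefinement

/-! ### Spectral and Frobenius norms. -/

section OperatorNorm

open scoped Matrix.Norms.L2Operator
open Matrix

variable {k l m n r : ℕ}

theorem toEuclideanLin_mul_apply (A : Matrix (Fin k) (Fin l) ℝ) (B : Matrix (Fin l) (Fin m) ℝ)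
    (x : EuclideanSpace ℝ (Fin m)) :
    toEuclideanLin (A * B) x = toEuclideanLin A (toEuclideanLin B x) := by
  simp [toLpLin_apply, Matrix.mulVec_mulVec]

theorem inner_toEuclideanLin (A : Matrix (Fin k) (Fin l) ℝ) (x : EuclideanSpace ℝ (Fin l))
    (y : EuclideanSpace ℝ (Fin k)) :
    inner ℝ (toEuclideanLin A x) y = inner ℝ x (toEuclideanLin Aᵀ y) := by
  simp only [toLpLin_apply, EuclideanSpace.inner_eq_star_dotProduct, star_trivial]
  rw [Matrix.dotProduct_mulVec, ← Matrix.mulVec_transpose, dotProduct_comm]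

theorem norm_toEuclideanLin_le (A : Matrix (Fin k) (Fin l) ℝ) (x : EuclideanSpace ℝ (Fin l)) :
    ‖toEuclideanLin A x‖ ≤ ‖A‖ * ‖x‖ :=
  l2_opNorm_mulVec A x

theorem opNorm_le_of_forall {A : Matrix (Fin k) (Fin l) ℝ} {c : ℝ} (hc : 0 ≤ c)
    (h : ∀ x, ‖toEuclideanLin A x‖ ≤ c * ‖x‖) : ‖A‖ ≤ c := by
  rw [l2_opNorm_def]
  exact ContinuousLinearMap.opNorm_le_bound _ hc h

theorem norm_transpose_eq (A : Matrix (Fin k) (Fin l) ℝ) : ‖Aᵀ‖ = ‖A‖ := by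
  simpa using l2_opNorm_conjTranspose A

theorem norm_transpose_mul_self (A : Matrix (Fin k) (Fin l) ℝ) : ‖Aᵀ * A‖ = ‖A‖ * ‖A‖ := by
  simpa using l2_opNorm_conjTranspose_mul_self A

theorem norm_diagonal_le {v : Fin k → ℝ} {c : ℝ} (hc : 0 ≤ c) (h : ∀ i, |v i| ≤ c) :
    ‖Matrix.diagonal v‖ ≤ c := by
  rw [l2_opNorm_diagonal]
  exact (pi_norm_le_iff_of_nonneg hc).2 h

theorem norm_le_one_of_transpose_mul_self {Q : Matrix (Fin m) (Fin r) ℝ} (hQ : Qᵀ * Q = 1) :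
    ‖Q‖ ≤ 1 := by
  have h := norm_transpose_mul_self Q
  have h1 : ‖(1 : Matrix (Fin r) (Fin r) ℝ)‖ ≤ 1 := by
    rw [← Matrix.diagonal_one]
    exact norm_diagonal_le zero_le_one (by simp)
  rw [hQ] at h
  nlinarith [norm_nonneg Q]

theorem norm_toEuclideanLin_sq (A : Matrix (Fin k) (Fin l) ℝ) (x : EuclideanSpace ℝ (Fin l)) :
    ‖toEuclideanLin A x‖ ^ 2 = inner ℝ x (toEuclideanLin (Aᵀ * A) x) := by
  rw [← real_inner_self_eq_norm_sq, inner_toEuclideanLin, toEuclideanLin_mul_apply]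

theorem norm_toEuclideanLin_of_orthonormal {Q : Matrix (Fin m) (Fin r) ℝ} (hQ : Qᵀ * Q = 1)
    (x : EuclideanSpace ℝ (Fin r)) : ‖toEuclideanLin Q x‖ = ‖x‖ := by
  have h := norm_toEuclideanLin_sq Q x
  rw [hQ, toLpLin_one, LinearMap.id_apply, real_inner_self_eq_norm_sq] at h
  exact (sq_eq_sq₀ (norm_nonneg _) (norm_nonneg _)).1 h

/-- A square matrix that is bounded below is invertible, with the reciprocal bound. -/
theorem isUnit_of_bounded_below {Z : Matrix (Fin r) (Fin r) ℝ} {κ : ℝ} (hκ : 0 < κ)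
    (h : ∀ x, κ * ‖x‖ ≤ ‖toEuclideanLin Z x‖) : IsUnit Z.det ∧ ‖Z⁻¹‖ ≤ κ⁻¹ := by
  have hu : IsUnit Z := by
    rw [← Matrix.mulVec_injective_iff_isUnit]
    refine (injective_iff_map_eq_zero (Matrix.mulVecLin Z)).2 fun x hx => ?_
    have := h (WithLp.toLp 2 x)
    have hx' : Z *ᵥ x = 0 := hx
    rw [toLpLin_toLp, toLin'_apply, hx'] at this
    have h0 : ‖WithLp.toLp 2 x‖ = 0 := by
      have : κ * ‖WithLp.toLp 2 x‖ ≤ 0 := by simpa using this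
      nlinarith [norm_nonneg (WithLp.toLp 2 x)]
    simpa using h0
  have hd := (Matrix.isUnit_iff_isUnit_det Z).1 hu
  refine ⟨hd, opNorm_le_of_forall (by positivity) fun x => ?_⟩
  have := h (toEuclideanLin Z⁻¹ x)
  rw [← toEuclideanLin_mul_apply, Matrix.mul_nonsing_inv _ hd, toLpLin_one,
    LinearMap.id_apply] at this
  rw [inv_mul_eq_div, le_div_iff₀ hκ]
  linarith

/-- The sum of the squares of the entries. -/
def froSq (A : Matrix (Fin k) (Fin l) ℝ) : ℝ := ∑ i, ∑ j, A i j ^ 2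

theorem froSq_nonneg (A : Matrix (Fin k) (Fin l) ℝ) : 0 ≤ froSq A :=
  Finset.sum_nonneg fun _ _ => Finset.sum_nonneg fun _ _ => sq_nonneg _

theorem froSq_eq_sum_norm (A : Matrix (Fin k) (Fin l) ℝ) :
    froSq A = ∑ j, ‖toEuclideanLin A (EuclideanSpace.single j 1)‖ ^ 2 := by
  rw [froSq, Finset.sum_comm]
  refine Finset.sum_congr rfl fun j _ => ?_
  rw [EuclideanSpace.norm_sq_eq]
  simp [toLpLin_apply]

theorem froSq_mul_le (A : Matrix (Fin k) (Fin l) ℝ) (B : Matrix (Fin l) (Fin m) ℝ) :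
    froSq (A * B) ≤ ‖A‖ ^ 2 * froSq B := by
  rw [froSq_eq_sum_norm, froSq_eq_sum_norm, Finset.mul_sum]
  refine Finset.sum_le_sum fun j _ => ?_
  rw [toEuclideanLin_mul_apply, ← mul_pow]
  exact pow_le_pow_left₀ (norm_nonneg _) (norm_toEuclideanLin_le _ _) 2

theorem froSq_le_card_mul (A : Matrix (Fin k) (Fin l) ℝ) : froSq A ≤ l * ‖A‖ ^ 2 := by
  rw [froSq_eq_sum_norm]
  refine (Finset.sum_le_card_nsmul _ _ (‖A‖ ^ 2) fun j _ => ?_).trans (by simp)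
  have := norm_toEuclideanLin_le A (EuclideanSpace.single j 1)
  exact pow_le_pow_left₀ (norm_nonneg _) (by simpa using this) 2

theorem norm_sq_le_froSq (A : Matrix (Fin k) (Fin l) ℝ) : ‖A‖ ^ 2 ≤ froSq A := by
  have h : ‖A‖ ≤ √(froSq A) := by
    refine opNorm_le_of_forall (Real.sqrt_nonneg _) fun x => ?_
    refine le_of_sq_le_sq ?_ (by positivity)
    rw [mul_pow, Real.sq_sqrt (froSq_nonneg A), EuclideanSpace.norm_sq_eq, EuclideanSpace.norm_sq_eq,
      froSq, Finset.sum_mul]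
    refine Finset.sum_le_sum fun i _ => ?_
    simpa [toLpLin_apply, mulVec, dotProduct] using
      Finset.sum_mul_sq_le_sq_mul_sq Finset.univ (A i) x.ofLp
  calc ‖A‖ ^ 2 ≤ √(froSq A) ^ 2 := pow_le_pow_left₀ (norm_nonneg _) h 2
    _ = froSq A := Real.sq_sqrt (froSq_nonneg A)

theorem abs_entry_le_norm (A : Matrix (Fin k) (Fin l) ℝ) (i : Fin k) (j : Fin l) :
    |A i j| ≤ ‖A‖ := by
  have h := norm_toEuclideanLin_le A (EuclideanSpace.single j 1)
  have h2 := PiLp.norm_apply_le (toEuclideanLin A (EuclideanSpace.single j 1)) i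
  simpa [toLpLin_apply] using h2.trans h

theorem froSq_transpose (A : Matrix (Fin k) (Fin l) ℝ) : froSq Aᵀ = froSq A := by
  rw [froSq, froSq, Finset.sum_comm]; rfl

end OperatorNorm

theorem frobeniusNorm_sq {k l : ℕ} (A : Matrix (Fin k) (Fin l) ℝ) :
    frobeniusNorm A ^ 2 = froSq A := by
  rw [frobeniusNorm, Matrix.frobenius_norm_def, ← Real.sqrt_eq_rpow, Real.sq_sqrt]
  · simp [froSq]
  · positivity

theorem frobeniusNorm_nonneg {k l : ℕ} (A : Matrix (Fin k) (Fin l) ℝ) : 0 ≤ frobeniusNorm A := by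
  rw [frobeniusNorm, Matrix.frobenius_norm_def]
  positivity

/-! ### Principal angle distance in matrix terms. -/

section Distance

open scoped Matrix.Norms.L2Operator
open Matrix

variable {m r s : ℕ}

theorem principalAngleDist_le_iff {E F : Submodule ℝ (EuclideanSpace ℝ (Fin m))} {c : ℝ}
    (hc : 0 ≤ c) :
    principalAngleDist E F ≤ c ↔ (∀ v ∈ F, ‖Eᗮ.starProjection v‖ ≤ c * ‖v‖) ∧
      ∀ v ∈ E, ‖Fᗮ.starProjection v‖ ≤ c * ‖v‖ := by
  have key (E F : Submodule ℝ (EuclideanSpace ℝ (Fin m))) :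
      ‖(Eᗮ.orthogonalProjectionOnto).comp F.subtypeL‖ ≤ c ↔
        ∀ v ∈ F, ‖Eᗮ.starProjection v‖ ≤ c * ‖v‖ := by
    rw [ContinuousLinearMap.opNorm_le_iff hc]
    exact ⟨fun h v hv => h ⟨v, hv⟩, fun h v => h v v.2⟩
  rw [principalAngleDist, max_le_iff, key, key]

theorem mem_colSpan_orthogonal {A : Matrix (Fin m) (Fin r) ℝ} {v : EuclideanSpace ℝ (Fin m)} :
    v ∈ (colSpan A)ᗮ ↔ toEuclideanLin Aᵀ v = 0 := by
  rw [Submodule.mem_orthogonal]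
  constructor
  · intro h
    have := h _ ⟨toEuclideanLin Aᵀ v, rfl⟩
    rw [inner_toEuclideanLin] at this
    exact inner_self_eq_zero.1 this
  · rintro h _ ⟨x, rfl⟩
    rw [inner_toEuclideanLin, h, inner_zero_right]

theorem starProjection_colSpan_orthogonal {Q : Matrix (Fin m) (Fin r) ℝ} (hQ : Qᵀ * Q = 1)
    (v : EuclideanSpace ℝ (Fin m)) :
    (colSpan Q)ᗮ.starProjection v = toEuclideanLin (1 - Q * Qᵀ) v := by
  refine Submodule.eq_starProjection_of_mem_orthogonal ?_ ?_
  · rw [mem_colSpan_orthogonal, ← toEuclideanLin_mul_apply, Matrix.mul_sub, ← Matrix.mul_assoc, hQ]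
    simp
  · refine Submodule.le_orthogonal_orthogonal _ ⟨toEuclideanLin Qᵀ v, ?_⟩
    rw [← toEuclideanLin_mul_apply]
    simp [toLpLin_apply]

theorem colSpan_mul_isUnit (Q : Matrix (Fin m) (Fin r) ℝ) {R : Matrix (Fin r) (Fin r) ℝ}
    (hR : IsUnit R.det) : colSpan (Q * R) = colSpan Q := by
  apply le_antisymm
  · rintro _ ⟨x, rfl⟩
    exact ⟨toEuclideanLin R x, (toEuclideanLin_mul_apply _ _ _).symm⟩
  · rintro _ ⟨x, rfl⟩
    refine ⟨toEuclideanLin R⁻¹ x, ?_⟩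
    rw [← toEuclideanLin_mul_apply, Matrix.mul_assoc, Matrix.mul_nonsing_inv _ hR, Matrix.mul_one]

/-- Small distance of the column spans in terms of orthonormal bases. -/
theorem norm_le_of_principalAngleDist_le {Q : Matrix (Fin m) (Fin r) ℝ}
    {P : Matrix (Fin m) (Fin s) ℝ} (hQ : Qᵀ * Q = 1) (hP : Pᵀ * P = 1) {c : ℝ} (hc : 0 ≤ c)
    (h : principalAngleDist (colSpan Q) (colSpan P) ≤ c) :
    ‖(1 - Q * Qᵀ) * P‖ ≤ c ∧ ‖(1 - P * Pᵀ) * Q‖ ≤ c := by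
  obtain ⟨h1, h2⟩ := (principalAngleDist_le_iff hc).1 h
  constructor <;> refine opNorm_le_of_forall hc fun x => ?_
  · have := h1 (toEuclideanLin P x) ⟨x, rfl⟩
    rwa [starProjection_colSpan_orthogonal hQ, ← toEuclideanLin_mul_apply,
      norm_toEuclideanLin_of_orthonormal hP] at this
  · have := h2 (toEuclideanLin Q x) ⟨x, rfl⟩
    rwa [starProjection_colSpan_orthogonal hP, ← toEuclideanLin_mul_apply,
      norm_toEuclideanLin_of_orthonormal hQ] at this

/-- Projecting onto `Eᗮ` kills `w`, so any competitor `w ∈ E` bounds the distance of `v` to `E`. -/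
theorem norm_starProjection_orthogonal_le {E : Submodule ℝ (EuclideanSpace ℝ (Fin m))}
    {w : EuclideanSpace ℝ (Fin m)} (hw : w ∈ E) (v : EuclideanSpace ℝ (Fin m)) :
    ‖Eᗮ.starProjection v‖ ≤ ‖v - w‖ := by
  have h0 : Eᗮ.starProjection w = 0 :=
    (Submodule.starProjection_apply_eq_zero_iff _).2 (Submodule.le_orthogonal_orthogonal _ hw)
  calc ‖Eᗮ.starProjection v‖ = ‖Eᗮ.starProjection (v - w)‖ := by rw [map_sub, h0, sub_zero]
    _ ≤ ‖v - w‖ := Submodule.norm_starProjection_apply_le _ _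

/-- The distance of the graph `T` of a small perturbation from the column span of `P`. -/
theorem principalAngleDist_le_of_graph {T P : Matrix (Fin m) (Fin r) ℝ} (hP : Pᵀ * P = 1)
    (hT : Pᵀ * T = 1) : principalAngleDist (colSpan T) (colSpan P) ≤ ‖T - P‖ := by
  refine (principalAngleDist_le_iff (norm_nonneg _)).2 ⟨?_, ?_⟩
  · rintro _ ⟨x, rfl⟩
    refine (norm_starProjection_orthogonal_le (E := colSpan T) (w := toEuclideanLin T x) ⟨x, rfl⟩ _).trans ?_
    rw [norm_toEuclideanLin_of_orthonormal hP, norm_sub_rev, ← LinearMap.sub_apply, ← map_sub]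
    exact norm_toEuclideanLin_le _ _
  · rintro _ ⟨x, rfl⟩
    refine (norm_starProjection_orthogonal_le (E := colSpan P) (w := toEuclideanLin P x) ⟨x, rfl⟩ _).trans ?_
    rw [← LinearMap.sub_apply, ← map_sub]
    refine (norm_toEuclideanLin_le _ _).trans (mul_le_mul_of_nonneg_left ?_ (norm_nonneg _))
    -- `Pᵀ` is a contraction and a left inverse of `T`, so `T` cannot shrink vectors.
    have h1 : toEuclideanLin Pᵀ (toEuclideanLin T x) = x := by
      rw [← toEuclideanLin_mul_apply, hT, toLpLin_one, LinearMap.id_apply]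
    calc ‖x‖ = ‖toEuclideanLin Pᵀ (toEuclideanLin T x)‖ := by rw [h1]
      _ ≤ ‖Pᵀ‖ * ‖toEuclideanLin T x‖ := norm_toEuclideanLin_le _ _
      _ ≤ 1 * ‖toEuclideanLin T x‖ := by
        rw [norm_transpose_eq]
        exact mul_le_mul_of_nonneg_right (norm_le_one_of_transpose_mul_self hP) (norm_nonneg _)
      _ = _ := one_mul _

/-- A kernel vector `x` of `(Q * R)ᵀ * P` would make `P x` orthogonal to the span of `Q * R`, hence
at full distance from it, against `c < 1`. So `Rᵀ * (Qᵀ * P)` is invertible, and with it `R`. -/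
theorem isUnit_of_principalAngleDist_lt_one {Q P : Matrix (Fin m) (Fin r) ℝ}
    {R : Matrix (Fin r) (Fin r) ℝ} (hP : Pᵀ * P = 1) {c : ℝ} (hc : 0 ≤ c) (hc1 : c < 1)
    (h : principalAngleDist (colSpan (Q * R)) (colSpan P) ≤ c) : IsUnit R.det := by
  obtain ⟨h1, -⟩ := (principalAngleDist_le_iff hc).1 h
  have hu : IsUnit ((Q * R)ᵀ * P) := by
    rw [← Matrix.mulVec_injective_iff_isUnit]
    refine (injective_iff_map_eq_zero (Matrix.mulVecLin ((Q * R)ᵀ * P))).2 fun x hx => ?_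
    have hx' : toEuclideanLin (Q * R)ᵀ (toEuclideanLin P (WithLp.toLp 2 x)) = 0 := by
      rw [← toEuclideanLin_mul_apply, toLpLin_toLp]
      exact congrArg (WithLp.toLp 2) hx
    have := h1 (toEuclideanLin P (WithLp.toLp 2 x)) ⟨_, rfl⟩
    rw [Submodule.starProjection_eq_self_iff.2 (mem_colSpan_orthogonal.2 hx'),
      norm_toEuclideanLin_of_orthonormal hP] at this
    have h0 : ‖WithLp.toLp 2 x‖ = 0 := by nlinarith [norm_nonneg (WithLp.toLp 2 x)]
    simpa using h0
  rw [Matrix.isUnit_iff_isUnit_det, Matrix.transpose_mul, Matrix.mul_assoc, Matrix.det_mul,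
    Matrix.det_transpose] at hu
  exact isUnit_of_mul_isUnit_left hu

end Distance

/-! ### Variance of sums of independent draws. -/

section IndependentSums

variable {d : ℕ}

theorem sum_fin_succ_pi {l : ℕ} (F : (Fin (l + 1) → Fin d) → ℝ) :
    ∑ ω, F ω = ∑ a, ∑ ω : Fin l → Fin d, F (Fin.cons a ω) := by
  rw [← (Fin.consEquiv fun _ : Fin (l + 1) => Fin d).sum_comp, Fintype.sum_prod_type]
  rfl

theorem sum_prod_eq_one {a : Fin d → ℝ} (ha : ∑ i, a i = 1) (l : ℕ) :
    ∑ ω : Fin l → Fin d, ∏ t, a (ω t) = 1 := by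
  induction l with
  | zero => simp
  | succ l ih =>
    rw [sum_fin_succ_pi]
    simp [Fin.prod_univ_succ, ← Finset.mul_sum, ih, ha]

/-- This makes the cross terms vanish in the variance computation. -/
theorem sum_prod_mul_sum_eq_zero {a h : Fin d → ℝ} (ha : ∑ i, a i = 1) (hh : ∑ i, a i * h i = 0)
    (l : ℕ) : ∑ ω : Fin l → Fin d, (∏ t, a (ω t)) * ∑ t, h (ω t) = 0 := by
  induction l with
  | zero => simp
  | succ l ih =>
    rw [sum_fin_succ_pi]
    have key (i : Fin d) : ∑ ω : Fin l → Fin d, (∏ t, a (Fin.cons (α := fun _ => Fin d) i ω t)) *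
        ∑ t, h (Fin.cons (α := fun _ => Fin d) i ω t) = a i * h i := by
      calc _ = ∑ ω : Fin l → Fin d, (a i * h i * ∏ t, a (ω t) +
            a i * ((∏ t, a (ω t)) * ∑ t, h (ω t))) := by
            refine Finset.sum_congr rfl fun ω _ => ?_
            simp only [Fin.prod_univ_succ, Fin.sum_univ_succ, Fin.cons_zero, Fin.cons_succ]
            ring
        _ = _ := by
            rw [Finset.sum_add_distrib, ← Finset.mul_sum, ← Finset.mul_sum, ih,
              sum_prod_eq_one ha]
            ring
    simp only [key, hh]

/-- The variance of a sum of independent centred variables is the sum of the variances. -/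
theorem sum_prod_mul_sq_sum {a h : Fin d → ℝ} (ha : ∑ i, a i = 1) (hh : ∑ i, a i * h i = 0)
    (l : ℕ) : ∑ ω : Fin l → Fin d, (∏ t, a (ω t)) * (∑ t, h (ω t)) ^ 2 =
      l * ∑ i, a i * h i ^ 2 := by
  induction l with
  | zero => simp
  | succ l ih =>
    rw [sum_fin_succ_pi]
    have key (i : Fin d) : ∑ ω : Fin l → Fin d, (∏ t, a (Fin.cons (α := fun _ => Fin d) i ω t)) *
        (∑ t, h (Fin.cons (α := fun _ => Fin d) i ω t)) ^ 2 =
        a i * h i ^ 2 + a i * (l * ∑ i, a i * h i ^ 2) := by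
      calc _ = ∑ ω : Fin l → Fin d, (a i * h i ^ 2 * ∏ t, a (ω t) +
            2 * (a i * h i) * ((∏ t, a (ω t)) * ∑ t, h (ω t)) +
            a i * ((∏ t, a (ω t)) * (∑ t, h (ω t)) ^ 2)) := by
            refine Finset.sum_congr rfl fun ω _ => ?_
            simp only [Fin.prod_univ_succ, Fin.sum_univ_succ, Fin.cons_zero, Fin.cons_succ]
            ring
        _ = _ := by
            rw [Finset.sum_add_distrib, Finset.sum_add_distrib, ← Finset.mul_sum,
              ← Finset.mul_sum, ← Finset.mul_sum, ih, sum_prod_eq_one ha,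
              sum_prod_mul_sum_eq_zero ha hh]
            ring
    simp only [key, Finset.sum_add_distrib, ← Finset.sum_mul, ha]
    push_cast
    ring

/-- The mean square error of the importance sampling estimate of `∑ i, g i`. -/
theorem sum_prod_mul_sq_sub_le {a g : Fin d → ℝ} (ha : ∑ i, a i = 1) (hpos : ∀ i, 0 < a i)
    {l : ℕ} (hl : 0 < l) :
    ∑ ω : Fin l → Fin d, (∏ t, a (ω t)) * (∑ t, g (ω t) / (l * a (ω t)) - ∑ i, g i) ^ 2 ≤
      (∑ i, g i ^ 2 / a i) / l := by
  have hl' : (l : ℝ) ≠ 0 := by positivity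
  obtain ⟨s, hs⟩ : ∃ s, s = ∑ i, g i := ⟨_, rfl⟩
  obtain ⟨h, hh⟩ : ∃ h : Fin d → ℝ, h = fun i => g i / a i - s := ⟨_, rfl⟩
  have hag (i : Fin d) : a i * h i = g i - s * a i := by
    rw [hh]; field_simp [(hpos i).ne']
  have h0 : ∑ i, a i * h i = 0 := by
    simp only [hag, Finset.sum_sub_distrib, ← Finset.mul_sum, ha]
    simp [hs]
  -- The variance is the second moment minus `s ^ 2`, which is dropped.
  have h2 : ∑ i, a i * h i ^ 2 ≤ ∑ i, g i ^ 2 / a i := by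
    have h3 (i : Fin d) : a i * h i ^ 2 = g i ^ 2 / a i - 2 * s * g i + s ^ 2 * a i := by
      rw [hh]; field_simp [(hpos i).ne']; ring
    simp only [h3, Finset.sum_add_distrib, Finset.sum_sub_distrib, ← Finset.mul_sum, ha, ← hs]
    nlinarith [sq_nonneg s]
  have hterm (ω : Fin l → Fin d) :
      ∑ t, g (ω t) / (l * a (ω t)) - ∑ i, g i = (∑ t, h (ω t)) / l := by
    rw [hh, ← hs, Finset.sum_sub_distrib, sub_div, Finset.sum_div]
    congr 1
    · refine Finset.sum_congr rfl fun t _ => ?_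
      rw [div_div, mul_comm]
    · simp [hl']
  calc _ = (∑ ω : Fin l → Fin d, (∏ t, a (ω t)) * (∑ t, h (ω t)) ^ 2) / l ^ 2 := by
        rw [Finset.sum_div]
        refine Finset.sum_congr rfl fun ω _ => ?_
        rw [hterm, div_pow, mul_div_assoc]
    _ = (∑ i, a i * h i ^ 2) / l := by
        rw [sum_prod_mul_sq_sum ha h0]; field_simp
    _ ≤ _ := by gcongr

end IndependentSums

/-! ### Markov's inequality. -/

section Markov

theorem toOuterMeasure_le_of_expectation {α : Type*} [Fintype α] (p : PMF α) {Z : α → ℝ}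
    (hZ : ∀ x, 0 ≤ Z x) {c : ℝ} (hc : 0 < c) :
    p.toOuterMeasure {x | c ≤ Z x} ≤ ENNReal.ofReal ((∑ x, (p x).toReal * Z x) / c) := by
  rw [PMF.toOuterMeasure_apply_fintype, Finset.sum_div,
    ENNReal.ofReal_sum_of_nonneg fun x _ =>
      div_nonneg (mul_nonneg ENNReal.toReal_nonneg (hZ x)) hc.le]
  refine Finset.sum_le_sum fun x _ => ?_
  by_cases hx : c ≤ Z x
  · rw [Set.indicator_of_mem (show x ∈ {x | c ≤ Z x} from hx)]
    calc p x = ENNReal.ofReal (p x).toReal := (ENNReal.ofReal_toReal (p.apply_ne_top x)).symm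
      _ ≤ _ := by
        refine ENNReal.ofReal_le_ofReal ?_
        rw [le_div_iff₀ hc]
        exact mul_le_mul_of_nonneg_left hx ENNReal.toReal_nonneg
  · rw [Set.indicator_of_notMem (show x ∉ {x | c ≤ Z x} from hx)]
    exact zero_le

end Markov

/-! ### Sampled matrix products. -/

section Sketch

open Matrix

variable {d l k r : ℕ}

/-- The sketching matrix `Dᵀ Sᵀ` of the drawn indices. -/
noncomputable def sketch (p : PMF (Fin d)) (ω : Fin l → Fin d) : Matrix (Fin l) (Fin d) ℝ :=
  (rescalingMatrix p ω)ᵀ * (samplingMatrix ω)ᵀ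

theorem sketch_mul_apply (p : PMF (Fin d)) (ω : Fin l → Fin d) (Y : Matrix (Fin d) (Fin k) ℝ)
    (t : Fin l) (b : Fin k) :
    (sketch p ω * Y) t b = 1 / √((l : ℝ) * (p (ω t)).toReal) * Y (ω t) b := by
  rw [sketch, rescalingMatrix, Matrix.diagonal_transpose, Matrix.mul_assoc,
    Matrix.diagonal_mul]
  simp [samplingMatrix, Matrix.mul_apply]

/-- The two rescaling factors multiply to `1 / (l p)`, so each entry is the importance sampling
estimate of the corresponding entry of `Qᵀ * Y`. -/
theorem sketch_gram_apply (p : PMF (Fin d)) (ω : Fin l → Fin d) (Q : Matrix (Fin d) (Fin r) ℝ)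
    (Y : Matrix (Fin d) (Fin k) ℝ) (a : Fin r) (b : Fin k) :
    ((sketch p ω * Q)ᵀ * (sketch p ω * Y)) a b =
      ∑ t, Q (ω t) a * Y (ω t) b / (l * (p (ω t)).toReal) := by
  rw [Matrix.mul_apply]
  refine Finset.sum_congr rfl fun t _ => ?_
  rw [Matrix.transpose_apply, sketch_mul_apply, sketch_mul_apply]
  have h : (0 : ℝ) ≤ l * (p (ω t)).toReal := by positivity
  calc _ = Q (ω t) a * Y (ω t) b *
        (1 / (√((l : ℝ) * (p (ω t)).toReal) * √((l : ℝ) * (p (ω t)).toReal))) := by ring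
    _ = _ := by rw [Real.mul_self_sqrt h]; ring

theorem toReal_iidSample (p : PMF (Fin d)) (ω : Fin l → Fin d) :
    (iidSample p l ω).toReal = ∏ t, (p (ω t)).toReal := by
  simp [iidSample, ENNReal.toReal_prod]

theorem sum_toReal_eq_one (p : PMF (Fin d)) : ∑ i, (p i).toReal = 1 := by
  have h : ∑ j, p j = 1 := by rw [← tsum_fintype (L := .unconditional _)]; exact p.tsum_coe
  rw [← ENNReal.toReal_sum fun i _ => p.apply_ne_top i, h, ENNReal.toReal_one]

/-- The mean square error of the sampled product `(Dᵀ Sᵀ Q)ᵀ (Dᵀ Sᵀ Y)` as an estimate of `Qᵀ Y`,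
for a sampling distribution that dominates the row norms of `Q`. -/
theorem expectation_froSq_sketch_le {p : PMF (Fin d)} (hl : 0 < l) {Q : Matrix (Fin d) (Fin r) ℝ}
    {γ : Fin d → ℝ} (hγ : ∀ i, γ i = ∑ j, Q i j ^ 2) {β : ℝ} (hr : 0 < r)
    (hp : IsSamplingDist r β γ p) (Y : Matrix (Fin d) (Fin k) ℝ) :
    ∑ ω : Fin l → Fin d, (iidSample p l ω).toReal *
        froSq ((sketch p ω * Q)ᵀ * (sketch p ω * Y) - Qᵀ * Y) ≤ r / (β * l) * froSq Y := by
  obtain ⟨hβ, -, hpj⟩ := hp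
  calc _ = ∑ a, ∑ b, ∑ ω : Fin l → Fin d, (∏ t, (p (ω t)).toReal) *
          (∑ t, Q (ω t) a * Y (ω t) b / (l * (p (ω t)).toReal) - ∑ i, Q i a * Y i b) ^ 2 := by
        simp only [froSq, Finset.mul_sum, toReal_iidSample]
        rw [Finset.sum_comm]
        refine Finset.sum_congr rfl fun a _ => ?_
        rw [Finset.sum_comm]
        refine Finset.sum_congr rfl fun b _ => Finset.sum_congr rfl fun ω _ => ?_
        rw [Matrix.sub_apply, sketch_gram_apply, Matrix.mul_apply]
        rfl
    _ ≤ ∑ a, ∑ b, (∑ i, (Q i a * Y i b) ^ 2 / (p i).toReal) / l :=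
        Finset.sum_le_sum fun a _ => Finset.sum_le_sum fun b _ =>
          sum_prod_mul_sq_sub_le (g := fun i => Q i a * Y i b) (sum_toReal_eq_one p)
            (fun i => (hpj i).1) hl
    _ = ∑ i, (γ i / (p i).toReal) * (∑ b, Y i b ^ 2) / l := by
        simp only [← Finset.sum_div]
        congr 1
        simp only [hγ]
        rw [Finset.sum_congr rfl fun a _ => Finset.sum_comm, Finset.sum_comm]
        refine Finset.sum_congr rfl fun i _ => ?_
        rw [Finset.sum_div, Finset.sum_mul_sum]
        refine Finset.sum_congr rfl fun a _ => Finset.sum_congr rfl fun b _ => ?_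
        ring
    _ ≤ ∑ i, (r / β) * (∑ b, Y i b ^ 2) / l := by
        refine Finset.sum_le_sum fun i _ => ?_
        have hY : 0 ≤ ∑ b, Y i b ^ 2 := Finset.sum_nonneg fun _ _ => sq_nonneg _
        -- Sampling directed by leverage scores serves exactly to make this ratio bounded uniformly
        -- in `i`.
        have h1 : γ i / (p i).toReal ≤ r / β := by
          obtain ⟨h0, h1⟩ := hpj i
          have hr' : (0 : ℝ) < r := by exact_mod_cast hr
          rw [div_le_iff₀ hr'] at h1
          rw [div_le_div_iff₀ h0 hβ]
          linarith
        gcongr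
    _ = _ := by
        rw [← Finset.sum_div, ← Finset.mul_sum, froSq]
        field_simp

end Sketch

/-! ### Pseudo-inverse and duality of the two half-steps. -/

section Pseudoinverse

open Matrix

variable {k l : ℕ}

theorem pinv_of_isUnit {A : Matrix (Fin k) (Fin l) ℝ} (h : IsUnit (Aᵀ * A).det) :
    pinv A = (Aᵀ * A)⁻¹ * Aᵀ := by
  obtain ⟨h1, -, h3, -⟩ := pinv_spec A
  have h4 : Aᵀ * A * pinv A = Aᵀ := by
    calc Aᵀ * A * pinv A = Aᵀ * (A * pinv A)ᵀ := by rw [h3, Matrix.mul_assoc]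
      _ = (A * pinv A * A)ᵀ := by rw [Matrix.transpose_mul (A * pinv A)]
      _ = Aᵀ := by rw [h1]
  calc pinv A = (Aᵀ * A)⁻¹ * (Aᵀ * A * pinv A) := by
        rw [← Matrix.mul_assoc, Matrix.nonsing_inv_mul _ h, Matrix.one_mul]
    _ = _ := by rw [h4]

/-- The Penrose equations determine the pseudo-inverse. -/
theorem eq_pinv_of_penrose {A : Matrix (Fin k) (Fin l) ℝ} {X : Matrix (Fin l) (Fin k) ℝ}
    (h1 : A * X * A = A) (h2 : X * A * X = X) (h3 : (A * X)ᵀ = A * X) (h4 : (X * A)ᵀ = X * A) :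
    X = pinv A := by
  obtain ⟨g1, g2, g3, g4⟩ := pinv_spec A
  have e1 : A * X = A * pinv A := by
    calc A * X = (A * pinv A * A) * X := by rw [g1]
      _ = (A * pinv A)ᵀ * (A * X)ᵀ := by rw [g3, h3, ← Matrix.mul_assoc]
      _ = (A * X * A * pinv A)ᵀ := by
        rw [← Matrix.transpose_mul]; simp only [Matrix.mul_assoc]
      _ = A * pinv A := by rw [h1, g3]
  have e2 : X * A = pinv A * A := by
    calc X * A = X * (A * pinv A * A) := by rw [g1]
      _ = (X * A)ᵀ * (pinv A * A)ᵀ := by rw [g4, h4]; simp only [Matrix.mul_assoc]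
      _ = (pinv A * (A * X * A))ᵀ := by
        rw [← Matrix.transpose_mul]; simp only [Matrix.mul_assoc]
      _ = pinv A * A := by rw [h1, g4]
  calc X = X * (A * X) := by rw [← Matrix.mul_assoc, h2]
    _ = X * A * pinv A := by rw [e1, Matrix.mul_assoc]
    _ = pinv A := by rw [e2, g2]

/-- The formula defining `pinv` treats `A` and `Aᵀ` differently, but the Penrose equations are
symmetric under transposition. -/
theorem pinv_transpose (A : Matrix (Fin k) (Fin l) ℝ) : pinv Aᵀ = (pinv A)ᵀ := by
  obtain ⟨g1, g2, g3, g4⟩ := pinv_spec A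
  symm
  apply eq_pinv_of_penrose
  · rw [← Matrix.transpose_mul, ← Matrix.transpose_mul, ← Matrix.mul_assoc, g1]
  · rw [← Matrix.transpose_mul, ← Matrix.transpose_mul, ← Matrix.mul_assoc, g2]
  · rw [← Matrix.transpose_mul, g4, g4]
  · rw [← Matrix.transpose_mul, g3, g3]

theorem updateB_eq {m n r : ℕ} (M : Matrix (Fin m) (Fin n) ℝ) (A : Matrix (Fin m) (Fin r) ℝ)
    (p : PMF (Fin m)) (ω : Fin l → Fin m) :
    updateB M A p ω = pinv (sketch p ω * A) * (sketch p ω * M) := rfl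

/-- Transposition turns the column step for `M` into the row step for `Mᵀ`, so only the latter has
to be analysed. -/
theorem transpose_updateA {m n r : ℕ} (M : Matrix (Fin m) (Fin n) ℝ)
    (B : Matrix (Fin r) (Fin n) ℝ) (q : PMF (Fin n)) (ω : Fin l → Fin n) :
    (updateA M B q ω)ᵀ = updateB Mᵀ Bᵀ q ω := by
  rw [updateB_eq, updateA, sketch]
  simp only [Matrix.transpose_mul, ← pinv_transpose, Matrix.mul_assoc]

end Pseudoinverse

/-! ### Deterministic contraction of one half-step. -/

section HalfStep

open scoped Matrix.Norms.L2Operator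
open Matrix

variable {m n r l : ℕ}

/-- `P diag(s) P'ᵀ` is a truncated singular value decomposition of `M` whose retained singular
values are at least `σ`, with a residual of spectral norm at most `σ'`. -/
structure IsTruncatedSVD (M : Matrix (Fin m) (Fin n) ℝ) (P : Matrix (Fin m) (Fin r) ℝ)
    (P' : Matrix (Fin n) (Fin r) ℝ) (s : Fin r → ℝ) (σ σ' : ℝ) : Prop where
  left : Pᵀ * P = 1
  right : P'ᵀ * P' = 1
  mul_right : M * P' = P * Matrix.diagonal s
  mul_left : Mᵀ * P = P' * Matrix.diagonal s
  pos : 0 < σ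
  le : ∀ j, σ ≤ s j
  norm_le : ‖M - P * Matrix.diagonal s * P'ᵀ‖ ≤ σ'

theorem IsTruncatedSVD.transpose {M : Matrix (Fin m) (Fin n) ℝ} {P : Matrix (Fin m) (Fin r) ℝ}
    {P' : Matrix (Fin n) (Fin r) ℝ} {s : Fin r → ℝ} {σ σ' : ℝ} (h : IsTruncatedSVD M P P' s σ σ') :
    IsTruncatedSVD Mᵀ P' P s σ σ' where
  left := h.right
  right := h.left
  mul_right := h.mul_left
  mul_left := h.mul_right
  pos := h.pos
  le := h.le
  norm_le := by
    rw [← norm_transpose_eq]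
    simpa [Matrix.transpose_mul, Matrix.mul_assoc] using h.norm_le

theorem norm_sq_projection_compl {Q : Matrix (Fin m) (Fin r) ℝ} (hQ : Qᵀ * Q = 1)
    (v : EuclideanSpace ℝ (Fin m)) :
    ‖toEuclideanLin (1 - Q * Qᵀ) v‖ ^ 2 = ‖v‖ ^ 2 - ‖toEuclideanLin Qᵀ v‖ ^ 2 := by
  have h : (1 - Q * Qᵀ)ᵀ * (1 - Q * Qᵀ) = 1 - Qᵀᵀ * Qᵀ := by
    have : Q * Qᵀ * (Q * Qᵀ) = Q * Qᵀ := by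
      calc _ = Q * (Qᵀ * Q) * Qᵀ := by simp only [Matrix.mul_assoc]
        _ = _ := by rw [hQ, Matrix.mul_one]
    simp [Matrix.mul_sub, Matrix.sub_mul, this]
  rw [norm_toEuclideanLin_sq, h, map_sub, LinearMap.sub_apply, inner_sub_right,
    norm_toEuclideanLin_sq, toLpLin_one, LinearMap.id_apply, real_inner_self_eq_norm_sq]

theorem norm_projection_compl_le_one {Q : Matrix (Fin m) (Fin r) ℝ} (hQ : Qᵀ * Q = 1) :
    ‖1 - Q * Qᵀ‖ ≤ 1 := by
  refine opNorm_le_of_forall zero_le_one fun x => ?_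
  refine le_of_sq_le_sq ?_ (by positivity)
  rw [norm_sq_projection_compl hQ, one_mul]
  nlinarith [sq_nonneg ‖toEuclideanLin Qᵀ x‖]

/-- By Pythagoras `‖Qᵀ P x‖² ≥ (1 - 1/4) ‖x‖²`, and `0.866` is just below `√3 / 2`. -/
theorem bounded_below_of_norm_projection_compl_le {Q P : Matrix (Fin m) (Fin r) ℝ}
    (hQ : Qᵀ * Q = 1) (hP : Pᵀ * P = 1) (h : ‖(1 - Q * Qᵀ) * P‖ ≤ 1 / 2)
    (x : EuclideanSpace ℝ (Fin r)) : 0.866 * ‖x‖ ≤ ‖toEuclideanLin (Qᵀ * P) x‖ := by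
  have h1 := norm_sq_projection_compl hQ (toEuclideanLin P x)
  have h2 := norm_toEuclideanLin_le ((1 - Q * Qᵀ) * P) x
  rw [toEuclideanLin_mul_apply] at h2
  rw [norm_toEuclideanLin_of_orthonormal hP, ← toEuclideanLin_mul_apply Qᵀ] at h1
  have h3 : ‖toEuclideanLin (1 - Q * Qᵀ) (toEuclideanLin P x)‖ ≤ 1 / 2 * ‖x‖ :=
    h2.trans (mul_le_mul_of_nonneg_right h (norm_nonneg _))
  have h4 := pow_le_pow_left₀ (norm_nonneg _) h3 2
  refine le_of_sq_le_sq ?_ (norm_nonneg _)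
  nlinarith [sq_nonneg ‖x‖]

/-- A perturbation of a matrix that is bounded below is bounded below. -/
theorem bounded_below_add {Z E : Matrix (Fin r) (Fin r) ℝ} {κ e : ℝ}
    (h : ∀ x, κ * ‖x‖ ≤ ‖toEuclideanLin Z x‖) (hE : ‖E‖ ≤ e) (x : EuclideanSpace ℝ (Fin r)) :
    (κ - e) * ‖x‖ ≤ ‖toEuclideanLin (Z + E) x‖ := by
  have h1 := h x
  have h2 := (norm_toEuclideanLin_le E x).trans (mul_le_mul_of_nonneg_right hE (norm_nonneg x))
  have h3 : ‖toEuclideanLin Z x‖ ≤ ‖toEuclideanLin (Z + E) x‖ + ‖toEuclideanLin E x‖ := by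
    have := norm_sub_le (toEuclideanLin (Z + E) x) (toEuclideanLin E x)
    rwa [map_add, LinearMap.add_apply, add_sub_cancel_right, ← LinearMap.add_apply, ← map_add] at this
  linarith

/-- One sketched least squares step contracts the distance to the leading singular subspace, if
the sketch `T` preserves the relevant inner products. -/
theorem principalAngleDist_sketched_lstsq_le {M : Matrix (Fin m) (Fin n) ℝ}
    {P : Matrix (Fin m) (Fin r) ℝ} {P' : Matrix (Fin n) (Fin r) ℝ} {s : Fin r → ℝ} {σ σ' : ℝ}
    (h : IsTruncatedSVD M P P' s σ σ') (hσ' : 0 ≤ σ') (hσσ' : σ' ≤ σ / 2)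
    {Q : Matrix (Fin m) (Fin r) ℝ} {R : Matrix (Fin r) (Fin r) ℝ} (hQ : Qᵀ * Q = 1) {δ : ℝ}
    (hδ0 : 0 ≤ δ) (hδ : δ ≤ 1 / 2)
    (hdist : principalAngleDist (colSpan (Q * R)) (colSpan P) ≤ δ)
    {T : Matrix (Fin l) (Fin m) ℝ}
    (hG : ‖(T * Q)ᵀ * (T * Q) - 1‖ ≤ 1 / 160)
    (hTP : ‖(T * Q)ᵀ * (T * ((1 - Q * Qᵀ) * P))‖ ≤ 1 / 160)
    (hTK : ‖(T * Q)ᵀ * (T * ((1 - Q * Qᵀ) * (M - P * Matrix.diagonal s * P'ᵀ)))‖ ≤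
      δ * σ' / 80) :
    principalAngleDist (colSpan (pinv (T * (Q * R)) * (T * M))ᵀ) (colSpan P') ≤ 0.87 * δ := by
  -- `R` comes from an SVD and could be singular a priori; the distance bound excludes this.
  have hR : IsUnit R.det :=
    isUnit_of_principalAngleDist_lt_one h.left hδ0 (hδ.trans_lt (by norm_num)) hdist
  rw [colSpan_mul_isUnit Q hR] at hdist
  obtain ⟨hQP, hPQ⟩ := norm_le_of_principalAngleDist_le hQ h.left hδ0 hdist
  obtain ⟨G, hGdef⟩ : ∃ G, G = (T * Q)ᵀ * (T * Q) := ⟨_, rfl⟩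
  obtain ⟨K, hK⟩ : ∃ K, K = M - P * Matrix.diagonal s * P'ᵀ := ⟨_, rfl⟩
  rw [← hGdef] at hG
  rw [← hK] at hTK
  have hKn : ‖K‖ ≤ σ' := hK ▸ h.norm_le
  -- the Gram matrix of the sketched basis is invertible
  obtain ⟨hGu, hGi⟩ : IsUnit G.det ∧ ‖G⁻¹‖ ≤ 160 / 159 := by
    have := isUnit_of_bounded_below (Z := G) (κ := 159 / 160) (by norm_num) fun x => by
      have := bounded_below_add (Z := 1) (κ := 1) (fun x => by simp) hG x
      rw [add_sub_cancel] at this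
      linarith
    exact ⟨this.1, this.2.trans (by norm_num)⟩
  obtain ⟨N, hN⟩ : ∃ N, N = G⁻¹ * ((T * Q)ᵀ * T) := ⟨_, rfl⟩
  -- Split `Y` along the span of `Q` and its complement: `N` is exact on the first part, so only the
  -- second carries sampling error.
  have hNY {k : ℕ} (Y : Matrix (Fin m) (Fin k) ℝ) :
      N * Y = Qᵀ * Y + G⁻¹ * ((T * Q)ᵀ * (T * ((1 - Q * Qᵀ) * Y))) := by
    have h1 : N * (Q * (Qᵀ * Y)) = Qᵀ * Y := by
      calc N * (Q * (Qᵀ * Y)) = G⁻¹ * ((T * Q)ᵀ * (T * Q)) * (Qᵀ * Y) := by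
            rw [hN]; simp only [Matrix.mul_assoc]
        _ = Qᵀ * Y := by rw [← hGdef, Matrix.nonsing_inv_mul _ hGu, Matrix.one_mul]
    calc N * Y = N * (Q * (Qᵀ * Y)) + N * ((1 - Q * Qᵀ) * Y) := by
          rw [← Matrix.mul_add, Matrix.sub_mul, Matrix.one_mul, ← Matrix.mul_assoc Q,
            add_sub_cancel]
      _ = _ := by rw [h1, hN]; simp only [Matrix.mul_assoc]
  -- the component in the leading singular subspace
  obtain ⟨Z, hZ⟩ : ∃ Z, Z = N * P := ⟨_, rfl⟩
  obtain ⟨hZu, hZi⟩ : IsUnit Z.det ∧ ‖Z⁻¹‖ ≤ (0.859 : ℝ)⁻¹ := by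
    refine isUnit_of_bounded_below (by norm_num) fun x => ?_
    have hE : ‖G⁻¹ * ((T * Q)ᵀ * (T * ((1 - Q * Qᵀ) * P)))‖ ≤ 160 / 159 * (1 / 160) :=
      (l2_opNorm_mul _ _).trans (mul_le_mul hGi hTP (norm_nonneg _) (by norm_num))
    have := bounded_below_add
      (bounded_below_of_norm_projection_compl_le hQ h.left (hQP.trans hδ)) hE x
    rw [← hNY, ← hZ] at this
    -- The sampling error costs at most `1 / 159`, and `0.866 - 1 / 159 ≥ 0.859`.
    refine le_trans (mul_le_mul_of_nonneg_right (by norm_num) (norm_nonneg _)) this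
  -- the residual component
  have hPK : Pᵀ * K = 0 := by
    have h1 : Pᵀ * M = Matrix.diagonal s * P'ᵀ := by
      simpa [Matrix.transpose_mul] using congrArg Matrix.transpose h.mul_left
    rw [hK, Matrix.mul_sub, h1, Matrix.mul_assoc, ← Matrix.mul_assoc, h.left, Matrix.one_mul,
      sub_self]
  have hQK : ‖Qᵀ * K‖ ≤ δ * σ' := by
    -- Only the part of `Q` outside the span of `P` sees `K`; this is where the factor `δ` is
    -- gained.
    have h1 : Qᵀ * K = ((1 - P * Pᵀ) * Q)ᵀ * K := by
      simp [Matrix.transpose_mul, Matrix.sub_mul, Matrix.mul_assoc, hPK]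
    rw [h1]
    refine (l2_opNorm_mul _ _).trans (mul_le_mul ?_ hKn (norm_nonneg _) hδ0)
    rwa [norm_transpose_eq]
  have hNK : ‖N * K‖ ≤ 1.013 * (δ * σ') := by
    rw [hNY]
    have hE : ‖G⁻¹ * ((T * Q)ᵀ * (T * ((1 - Q * Qᵀ) * K)))‖ ≤ 160 / 159 * (δ * σ' / 80) :=
      (l2_opNorm_mul _ _).trans (mul_le_mul hGi hTK (norm_nonneg _) (by norm_num))
    refine (norm_add_le _ _).trans ((add_le_add hQK hE).trans ?_)
    nlinarith [mul_nonneg hδ0 hσ']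
  -- the row space of the least squares solution as a graph
  have hs (j : Fin r) : 0 < s j := h.pos.trans_le (h.le j)
  obtain ⟨S, hS⟩ : ∃ S : Matrix (Fin r) (Fin r) ℝ, S = Matrix.diagonal fun j => (s j)⁻¹ := ⟨_, rfl⟩
  have hSs : S * Matrix.diagonal s = 1 := by
    rw [hS, Matrix.diagonal_mul_diagonal, ← Matrix.diagonal_one]
    congr 1; ext j; exact inv_mul_cancel₀ (hs j).ne'
  have hSn : ‖S‖ ≤ σ⁻¹ := by
    rw [hS]
    refine norm_diagonal_le (inv_nonneg.2 h.pos.le) fun j => ?_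
    rw [abs_of_pos (inv_pos.2 (hs j))]
    exact inv_anti₀ h.pos (h.le j)
  -- Left multiplication by the invertible `L` keeps the row space and normalizes its `P'` component
  -- to the identity.
  obtain ⟨L, hL⟩ : ∃ L, L = S * Z⁻¹ := ⟨_, rfl⟩
  have hLNM : L * (N * M) * P' = 1 := by
    calc L * (N * M) * P' = L * (N * (M * P')) := by simp only [Matrix.mul_assoc]
      _ = S * (Z⁻¹ * Z) * Matrix.diagonal s := by
        rw [h.mul_right, hL, hZ]; simp only [Matrix.mul_assoc]
      _ = 1 := by rw [Matrix.nonsing_inv_mul _ hZu, Matrix.mul_one, hSs]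
  have hLu : IsUnit Lᵀ.det := by
    rw [Matrix.det_transpose, hL, Matrix.det_mul]
    refine IsUnit.mul ?_ ?_
    · rw [← Matrix.isUnit_iff_isUnit_det]
      exact IsUnit.of_mul_eq_one _ hSs
    · rw [Matrix.det_nonsing_inv]
      exact hZu.ringInverse
  have hB : pinv (T * (Q * R)) * (T * M) = R⁻¹ * (N * M) := by
    have h1 : (T * (Q * R))ᵀ * (T * (Q * R)) = Rᵀ * G * R := by
      rw [hGdef]; simp only [Matrix.transpose_mul, Matrix.mul_assoc]
    have hRt : IsUnit Rᵀ.det := by rwa [Matrix.det_transpose]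
    rw [pinv_of_isUnit, h1, Matrix.mul_inv_rev, Matrix.mul_inv_rev]
    · calc _ = R⁻¹ * (G⁻¹ * ((Rᵀ)⁻¹ * Rᵀ * ((T * Q)ᵀ * T))) * M := by
            simp only [Matrix.transpose_mul, Matrix.mul_assoc]
        _ = _ := by
            rw [Matrix.nonsing_inv_mul _ hRt, Matrix.one_mul, ← hN, Matrix.mul_assoc]
    · rw [h1, Matrix.det_mul, Matrix.det_mul]
      exact (hRt.mul hGu).mul hR
  have hspan : colSpan (pinv (T * (Q * R)) * (T * M))ᵀ = colSpan (L * (N * M))ᵀ := by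
    rw [hB, Matrix.transpose_mul R⁻¹, Matrix.transpose_mul L, colSpan_mul_isUnit _ hLu,
      colSpan_mul_isUnit]
    rw [Matrix.det_transpose, Matrix.det_nonsing_inv]
    exact hR.ringInverse
  rw [hspan]
  refine (principalAngleDist_le_of_graph h.right ?_).trans ?_
  · rw [← Matrix.transpose_mul, hLNM, Matrix.transpose_one]
  · have h1 : (L * (N * M))ᵀ - P' = (L * (N * K))ᵀ := by
      rw [hK, ← h.mul_right, Matrix.mul_sub, Matrix.mul_sub, Matrix.transpose_sub]
      congr 1
      calc P' = (L * (N * M) * P' * P'ᵀ)ᵀ := by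
            rw [hLNM, Matrix.one_mul, Matrix.transpose_transpose]
        _ = _ := by simp only [Matrix.mul_assoc]
    rw [h1, norm_transpose_eq]
    have h2 : ‖L‖ ≤ σ⁻¹ * (0.859 : ℝ)⁻¹ := by
      rw [hL]
      exact (l2_opNorm_mul _ _).trans
        (mul_le_mul hSn hZi (norm_nonneg _) (inv_nonneg.2 h.pos.le))
    have h3 : δ * σ' ≤ δ * (σ / 2) := mul_le_mul_of_nonneg_left hσσ' hδ0
    calc ‖L * (N * K)‖ ≤ ‖L‖ * ‖N * K‖ := l2_opNorm_mul _ _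
      _ ≤ σ⁻¹ * (0.859 : ℝ)⁻¹ * (1.013 * (δ * (σ / 2))) := by
        refine mul_le_mul h2 (hNK.trans (by linarith)) (norm_nonneg _) ?_
        have := h.pos
        positivity
      _ = (0.859 : ℝ)⁻¹ * 1.013 / 2 * δ := by
        field_simp [h.pos.ne']
      -- The actual factor is about `0.59`.
      _ ≤ 0.87 * δ := mul_le_mul_of_nonneg_right (by norm_num) hδ0

end HalfStep

/-! ### Probability that one sampled half-step contracts. -/

section SampledStep

open scoped Matrix.Norms.L2Operator
open Matrix

variable {m n r : ℕ}

theorem le_sampleSize (r : ℕ) (ε ξ β : ℝ) :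
    1296 * β⁻¹ * (r : ℝ) ^ 2 * (ε ^ 2)⁻¹ * (ξ ^ 4)⁻¹ ≤ sampleSize r ε ξ β :=
  Nat.le_ceil _

theorem norm_le_of_froSq_le {A : Matrix (Fin m) (Fin n) ℝ} {c : ℝ} (hc : 0 ≤ c)
    (h : froSq A ≤ c ^ 2) : ‖A‖ ≤ c :=
  le_of_sq_le_sq ((norm_sq_le_froSq A).trans h) hc

/-- One sampled least squares step contracts the distance with probability at least `1 - ξ`. -/
theorem toOuterMeasure_updateB_le (hr : 0 < r) {M : Matrix (Fin m) (Fin n) ℝ}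
    {P : Matrix (Fin m) (Fin r) ℝ} {P' : Matrix (Fin n) (Fin r) ℝ} {s : Fin r → ℝ} {σ σ' θ : ℝ}
    (h : IsTruncatedSVD M P P' s σ σ') (hσ' : 0 < σ') (hσσ' : σ' ≤ σ / 2) (hθ : 1 ≤ θ)
    (hK : froSq (M - P * Matrix.diagonal s * P'ᵀ) = (θ * σ') ^ 2)
    {ε ξ : ℝ} (hε : 0 < ε) (hεθ : 8 * θ * ε ≤ 1) (hξ0 : 0 < ξ) (hξ1 : ξ ≤ 1)
    {Q : Matrix (Fin m) (Fin r) ℝ} {R : Matrix (Fin r) (Fin r) ℝ} (hQ : Qᵀ * Q = 1)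
    {γ : Fin m → ℝ} (hγ : ∀ i, γ i = ∑ j, Q i j ^ 2) {β : ℝ} {p : PMF (Fin m)}
    (hp : IsSamplingDist r β γ p) {δ : ℝ} (hδ : δ ≤ 1 / 2) (hδε : 4 * θ * ε ≤ δ)
    (hdist : principalAngleDist (colSpan (Q * R)) (colSpan P) ≤ δ) :
    (iidSample p (sampleSize r ε ξ β)).toOuterMeasure
      {ω | ¬ principalAngleDist (colSpan (updateB M (Q * R) p ω)ᵀ) (colSpan P') ≤ 0.87 * δ} ≤
      ENNReal.ofReal ξ := by
  obtain ⟨l, hl⟩ : ∃ l, l = sampleSize r ε ξ β := ⟨_, rfl⟩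
  have hβ := hp.1
  have hr' : (1 : ℝ) ≤ r := by exact_mod_cast hr
  have hle : 1296 * β⁻¹ * (r : ℝ) ^ 2 * (ε ^ 2)⁻¹ * (ξ ^ 4)⁻¹ ≤ l := hl ▸ le_sampleSize r ε ξ β
  have hl0 : 0 < l := by
    have : (0 : ℝ) < l := lt_of_lt_of_le (by positivity) hle
    exact_mod_cast this
  -- The constant is `1296 = 3 * 432`; the `3` pays for the three error terms below.
  have hrate : (r : ℝ) / (β * l) * (3 * r) ≤ ε ^ 2 / 432 * ξ ^ 4 := by
    have hl0' : (0 : ℝ) < l := by exact_mod_cast hl0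
    have h1 : 1296 * (r : ℝ) ^ 2 ≤ l * (β * ε ^ 2 * ξ ^ 4) := by
      rw [← div_le_iff₀ (by positivity)]
      refine le_trans (le_of_eq ?_) hle
      field_simp
    rw [div_mul_eq_mul_div, div_le_iff₀ (by positivity)]
    nlinarith
  rw [← hl]
  obtain ⟨K, hKdef⟩ : ∃ K, K = M - P * Matrix.diagonal s * P'ᵀ := ⟨_, rfl⟩
  rw [← hKdef] at hK
  obtain ⟨Y, hY⟩ : ∃ Y, Y = (1 - Q * Qᵀ) * P := ⟨_, rfl⟩
  obtain ⟨X, hX⟩ : ∃ X, X = (1 - Q * Qᵀ) * K := ⟨_, rfl⟩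
  -- The products of `Q` with `Y` and `X` have true value zero, so their sampled values are pure
  -- error.
  have hQ0 {k : ℕ} (C : Matrix (Fin m) (Fin k) ℝ) : Qᵀ * ((1 - Q * Qᵀ) * C) = 0 := by
    rw [← Matrix.mul_assoc, Matrix.mul_sub, ← Matrix.mul_assoc, hQ]
    simp
  have hF : 0 < (θ * σ') ^ 2 := by positivity
  -- All three errors go into one variable, so that Markov's inequality is used once. The third is
  -- scaled by the squared Frobenius norm of `K`, so its mean is at most `r / (β * l)`.
  obtain ⟨Z, hZ⟩ : ∃ Z : (Fin l → Fin m) → ℝ, Z = fun ω =>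
      froSq ((sketch p ω * Q)ᵀ * (sketch p ω * Q) - Qᵀ * Q) +
      froSq ((sketch p ω * Q)ᵀ * (sketch p ω * Y) - Qᵀ * Y) +
      froSq ((sketch p ω * Q)ᵀ * (sketch p ω * X) - Qᵀ * X) / (θ * σ') ^ 2 := ⟨_, rfl⟩
  have hZ0 (ω : Fin l → Fin m) : 0 ≤ Z ω := by
    rw [hZ]
    exact add_nonneg (add_nonneg (froSq_nonneg _) (froSq_nonneg _))
      (div_nonneg (froSq_nonneg _) hF.le)
  have hfro {A : Matrix (Fin m) (Fin r) ℝ} (hA : ‖A‖ ≤ 1) : froSq A ≤ r := by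
    refine (froSq_le_card_mul A).trans (mul_le_of_le_one_right (by positivity) ?_)
    exact pow_le_one₀ (norm_nonneg _) hA
  have hproj := norm_projection_compl_le_one hQ
  have hfQ : froSq Q ≤ r := hfro (norm_le_one_of_transpose_mul_self hQ)
  have hfY : froSq Y ≤ r := by
    refine hfro (hY ▸ (l2_opNorm_mul _ _).trans ?_)
    exact mul_le_one₀ hproj (norm_nonneg _) (norm_le_one_of_transpose_mul_self h.left)
  have hfX : froSq X ≤ (θ * σ') ^ 2 := by
    rw [hX, ← hK]
    refine (froSq_mul_le _ _).trans (mul_le_of_le_one_left (froSq_nonneg _) ?_)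
    exact pow_le_one₀ (norm_nonneg _) hproj
  have hEZ : ∑ ω, (iidSample p l ω).toReal * Z ω ≤ ε ^ 2 / 432 * ξ ^ 4 := by
    have e1 := expectation_froSq_sketch_le hl0 hγ hr hp Q
    have e2 := expectation_froSq_sketch_le hl0 hγ hr hp Y
    have e3 := expectation_froSq_sketch_le hl0 hγ hr hp X
    have hc : (0 : ℝ) ≤ r / (β * l) := by positivity
    have e3' := div_le_div_of_nonneg_right
      (e3.trans (mul_le_mul_of_nonneg_left hfX hc)) hF.le
    rw [mul_div_assoc, div_self hF.ne', Finset.sum_div] at e3'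
    calc _ ≤ (r : ℝ) / (β * l) * r + r / (β * l) * r + r / (β * l) * 1 := by
          rw [hZ]
          simp only [mul_add, Finset.sum_add_distrib, ← mul_div_assoc]
          exact add_le_add (add_le_add (e1.trans (mul_le_mul_of_nonneg_left hfQ hc))
            (e2.trans (mul_le_mul_of_nonneg_left hfY hc))) e3'
      _ ≤ r / (β * l) * (3 * r) := by nlinarith
      _ ≤ _ := hrate
  have hc0 : (0 : ℝ) < ε ^ 2 / 432 := by positivity
  calc _ ≤ (iidSample p l).toOuterMeasure {ω | ε ^ 2 / 432 ≤ Z ω} := by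
        refine MeasureTheory.measure_mono fun ω hω => ?_
        by_contra hlt
        refine hω ?_
        have hlt : Z ω < ε ^ 2 / 432 := not_le.1 hlt
        have f1 := froSq_nonneg ((sketch p ω * Q)ᵀ * (sketch p ω * Q) - Qᵀ * Q)
        have f2 := froSq_nonneg ((sketch p ω * Q)ᵀ * (sketch p ω * Y) - Qᵀ * Y)
        have f3 := div_nonneg
          (froSq_nonneg ((sketch p ω * Q)ᵀ * (sketch p ω * X) - Qᵀ * X)) hF.le
        simp only [hZ] at hlt
        have hε8 : ε ≤ 1 / 8 := by nlinarith
        -- As `ε ≤ 1/8`, the left side is at most `1 / 27648`, while the right side is `1 / 25600`.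
        have hε2 : ε ^ 2 / 432 ≤ (1 / 160) ^ 2 := by nlinarith
        rw [updateB_eq]
        refine principalAngleDist_sketched_lstsq_le h hσ'.le hσσ' hQ
          (le_trans (by positivity) hδε) hδ hdist ?_ ?_ ?_
        · rw [← hQ]
          exact norm_le_of_froSq_le (by norm_num) (by linarith)
        · rw [← hY, ← sub_zero ((sketch p ω * Q)ᵀ * (sketch p ω * Y)),
            ← show Qᵀ * Y = 0 from hY ▸ hQ0 P]
          exact norm_le_of_froSq_le (by norm_num) (by linarith)
        · rw [← hKdef, ← hX, ← sub_zero ((sketch p ω * Q)ᵀ * (sketch p ω * X)),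
            ← show Qᵀ * X = 0 from hX ▸ hQ0 K]
          have f4 : froSq ((sketch p ω * Q)ᵀ * (sketch p ω * X) - Qᵀ * X) ≤
              (ε / 20 * (θ * σ')) ^ 2 := by
            rw [mul_pow, ← div_le_iff₀ hF]
            have : ε ^ 2 / 432 ≤ (ε / 20) ^ 2 := by
              rw [div_pow]
              gcongr
              norm_num
            linarith
          refine (norm_le_of_froSq_le (by positivity) f4).trans ?_
          -- The floor `4 * θ * ε ≤ δ` is needed here: it turns the error `ε * θ * σ' / 20` into `δ
          -- * σ' / 80`.
          have : 4 * θ * ε * σ' ≤ δ * σ' := mul_le_mul_of_nonneg_right hδε hσ'.le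
          linarith
    _ ≤ ENNReal.ofReal ((∑ ω, (iidSample p l ω).toReal * Z ω) / (ε ^ 2 / 432)) :=
        toOuterMeasure_le_of_expectation _ hZ0 hc0
    -- The Markov quotient is at most `ξ ^ 4`, hence at most `ξ`.
    _ ≤ ENNReal.ofReal ξ := by
        refine ENNReal.ofReal_le_ofReal ?_
        rw [div_le_iff₀ hc0]
        refine hEZ.trans ?_
        rw [mul_comm ξ]
        exact mul_le_mul_of_nonneg_left (pow_le_of_le_one hξ0.le hξ1 (by norm_num)) hc0.le

end SampledStep

/-! ### Consequences of a full SVD. -/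

section SingularValueDecomposition

open scoped Matrix.Norms.L2Operator
open Matrix

variable {m n r : ℕ}

theorem transpose_mul_self_of_mem_orthogonalGroup {U : Matrix (Fin m) (Fin m) ℝ}
    (hU : U ∈ Matrix.orthogonalGroup (Fin m) ℝ) : Uᵀ * U = 1 :=
  (Matrix.mem_orthogonalGroup_iff' (Fin m) ℝ).1 hU

/-- The rectangular diagonal matrix with diagonal `s`. -/
def rectDiagonal (m n : ℕ) (s : ℕ → ℝ) : Matrix (Fin m) (Fin n) ℝ :=
  Matrix.of fun i j => if (i : ℕ) = (j : ℕ) then s i else 0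

theorem transpose_rectDiagonal (s : ℕ → ℝ) : (rectDiagonal m n s)ᵀ = rectDiagonal n m s := by
  ext i j
  simp only [rectDiagonal, Matrix.transpose_apply, Matrix.of_apply]
  split_ifs with h1 h2 h2 <;> simp_all

/-- With column selection written as a product, truncations and SVD factorizations become products
of rectangular diagonal matrices. -/
theorem firstCols_eq (h : r ≤ m) (U : Matrix (Fin m) (Fin m) ℝ) :
    firstCols h U = U * rectDiagonal m r fun _ => 1 := by
  ext i j
  rw [Matrix.mul_apply, Finset.sum_eq_single (Fin.castLE h j)]
  · simp [firstCols, rectDiagonal]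
  · intro b _ hb
    have : (b : ℕ) ≠ j := fun hbj => hb (Fin.ext hbj)
    simp [rectDiagonal, this]
  · simp

theorem rectDiagonal_mul_rectDiagonal_eq_ite {k : ℕ} (s t : ℕ → ℝ) :
    rectDiagonal m k s * rectDiagonal k n t =
      rectDiagonal m n fun i => if i < k then s i * t i else 0 := by
  ext i j
  rw [Matrix.mul_apply]
  simp only [rectDiagonal, Matrix.of_apply]
  by_cases hij : (i : ℕ) = j
  · by_cases hi : (i : ℕ) < k
    · rw [Finset.sum_eq_single ⟨i, hi⟩]
      · simp [hij, hij ▸ hi]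
      · intro b _ hb
        have : (i : ℕ) ≠ b := fun hbj => hb (Fin.ext hbj.symm)
        simp [this]
      · simp
    · rw [if_pos hij, if_neg hi]
      refine Finset.sum_eq_zero fun b _ => ?_
      have : (i : ℕ) ≠ b := by omega
      simp [this]
  · rw [if_neg hij]
    refine Finset.sum_eq_zero fun b _ => ?_
    split_ifs with h1 h2
    · omega
    · simp
    · simp
    · simp

theorem rectDiagonal_mul_rectDiagonal {k : ℕ} (s t : ℕ → ℝ) (hk : m ≤ k ∨ n ≤ k) :
    rectDiagonal m k s * rectDiagonal k n t = rectDiagonal m n fun i => s i * t i := by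
  rw [rectDiagonal_mul_rectDiagonal_eq_ite]
  ext i j
  simp only [rectDiagonal, Matrix.of_apply]
  by_cases hij : (i : ℕ) = j
  · rw [if_pos hij, if_pos hij, if_pos (by omega)]
  · rw [if_neg hij, if_neg hij]

theorem rectDiagonal_self (s : ℕ → ℝ) :
    rectDiagonal r r s = Matrix.diagonal fun j : Fin r => s j := by
  ext i j
  simp [rectDiagonal, Matrix.diagonal_apply, Fin.ext_iff]

/-- A tall rectangular diagonal is an isometry times a square diagonal; the wide case follows by
transposing. -/
theorem norm_rectDiagonal_le {s : ℕ → ℝ} {c : ℝ} (hc : 0 ≤ c)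
    (hs : ∀ i, i < m → i < n → |s i| ≤ c) : ‖rectDiagonal m n s‖ ≤ c := by
  have key {k l : ℕ} (hlk : l ≤ k) (hs : ∀ i, i < l → |s i| ≤ c) : ‖rectDiagonal k l s‖ ≤ c := by
    have h1 : rectDiagonal k l s = rectDiagonal k l (fun _ => 1) * rectDiagonal l l s := by
      rw [rectDiagonal_mul_rectDiagonal _ _ (Or.inr le_rfl)]
      simp
    have h2 : (rectDiagonal k l fun _ => 1)ᵀ * (rectDiagonal k l fun _ => 1) = 1 := by
      rw [transpose_rectDiagonal, rectDiagonal_mul_rectDiagonal _ _ (Or.inl hlk), rectDiagonal_self]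
      simp
    rw [h1, rectDiagonal_self]
    refine (l2_opNorm_mul _ _).trans ?_
    exact (mul_le_of_le_one_left (norm_nonneg _) (norm_le_one_of_transpose_mul_self h2)).trans
      (norm_diagonal_le hc fun i => hs i i.2)
  rcases le_total n m with h | h
  · exact key h fun i hi => hs i (hi.trans_le h) hi
  · rw [← norm_transpose_eq, transpose_rectDiagonal]
    exact key h fun i hi => hs i hi (hi.trans_le h)

theorem firstCols_transpose_mul_self (h : r ≤ m) {U : Matrix (Fin m) (Fin m) ℝ}
    (hU : U ∈ Matrix.orthogonalGroup (Fin m) ℝ) : (firstCols h U)ᵀ * firstCols h U = 1 := by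
  rw [firstCols_eq, Matrix.transpose_mul, transpose_rectDiagonal, Matrix.mul_assoc,
    ← Matrix.mul_assoc Uᵀ, transpose_mul_self_of_mem_orthogonalGroup hU, Matrix.one_mul,
    rectDiagonal_mul_rectDiagonal _ _ (Or.inl h), rectDiagonal_self]
  simp

/-- A matrix with `r` columns factors through the first `r` left singular vectors. -/
theorem IsRowLeverage.exists_factorization {h : r ≤ m} {A : Matrix (Fin m) (Fin r) ℝ}
    {γ : Fin m → ℝ} (hγ : IsRowLeverage h A γ) :
    ∃ (Q : Matrix (Fin m) (Fin r) ℝ) (R : Matrix (Fin r) (Fin r) ℝ), Qᵀ * Q = 1 ∧ A = Q * R ∧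
      ∀ i, γ i = ∑ j, Q i j ^ 2 := by
  obtain ⟨U, V, ⟨hU, -, hA⟩, hγ⟩ := hγ
  refine ⟨firstCols h U, rectDiagonal r r (fun i => singularValue A (i + 1)) * Vᵀ,
    firstCols_transpose_mul_self h hU, ?_, hγ⟩
  -- As `A` has only `r` columns, its `m × r` diagonal factor has no nonzero rows beyond the first
  -- `r`, so nothing is lost and no rank assumption is needed.
  rw [firstCols_eq, Matrix.mul_assoc, ← Matrix.mul_assoc (rectDiagonal m r _),
    rectDiagonal_mul_rectDiagonal _ _ (Or.inr le_rfl), ← Matrix.mul_assoc]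
  simpa [rectDiagonal] using hA

theorem IsColLeverage.exists_factorization {h : r ≤ n} {B : Matrix (Fin r) (Fin n) ℝ}
    {γ : Fin n → ℝ} (hγ : IsColLeverage h B γ) :
    ∃ (Q : Matrix (Fin n) (Fin r) ℝ) (R : Matrix (Fin r) (Fin r) ℝ), Qᵀ * Q = 1 ∧ Bᵀ = Q * R ∧
      ∀ i, γ i = ∑ j, Q i j ^ 2 := by
  obtain ⟨U, V, ⟨-, hV, hB⟩, hγ⟩ := hγ
  refine ⟨firstCols h V, rectDiagonal r r (fun i => singularValue B (i + 1)) * Uᵀ,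
    firstCols_transpose_mul_self h hV, ?_, hγ⟩
  have hB' : B = U * rectDiagonal r n (fun i => singularValue B (i + 1)) * Vᵀ := hB
  have hBt := congrArg Matrix.transpose hB'
  rw [firstCols_eq, Matrix.mul_assoc, ← Matrix.mul_assoc (rectDiagonal n r _),
    rectDiagonal_mul_rectDiagonal _ _ (Or.inr le_rfl), hBt]
  simp [Matrix.transpose_mul, transpose_rectDiagonal]

theorem singularValue_nonneg (M : Matrix (Fin m) (Fin n) ℝ) (j : ℕ) : 0 ≤ singularValue M j :=
  LinearMap.singularValues_nonneg _ _

theorem singularValue_antitone (M : Matrix (Fin m) (Fin n) ℝ) : Antitone (singularValue M) :=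
  fun _ _ hij => LinearMap.singularValues_antitone _ (Nat.sub_le_sub_right hij 1)

theorem lt_of_singularValue_pos {M : Matrix (Fin m) (Fin n) ℝ} {j : ℕ}
    (h : 0 < singularValue M (j + 1)) : j < m ∧ j < n := by
  have h1 := (LinearMap.singularValues_pos_iff_lt_finrank_range _).1 h
  rw [Nat.add_sub_cancel] at h1
  constructor
  · refine h1.trans_le ((Submodule.finrank_le _).trans ?_)
    simp
  · refine h1.trans_le ((LinearMap.finrank_range_le _).trans ?_)
    simp

theorem residual_eq {hm : r ≤ m} {hn : r ≤ n} {M : Matrix (Fin m) (Fin n) ℝ}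
    {U : Matrix (Fin m) (Fin m) ℝ} {V : Matrix (Fin n) (Fin n) ℝ} (h : IsSVD M U V) :
    M - truncation hm hn M U V =
      U * rectDiagonal m n (fun i => if i < r then 0 else singularValue M (i + 1)) * Vᵀ := by
  have hM : M = U * rectDiagonal m n (fun i => singularValue M (i + 1)) * Vᵀ := h.2.2
  have ht : truncation hm hn M U V =
      U * rectDiagonal m n (fun i => if i < r then singularValue M (i + 1) else 0) * Vᵀ := by
    rw [truncation, firstCols_eq, firstCols_eq, Matrix.transpose_mul, transpose_rectDiagonal,
      ← rectDiagonal_self (fun j => singularValue M (j + 1)), Matrix.mul_assoc U,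
      rectDiagonal_mul_rectDiagonal _ _ (Or.inr le_rfl), ← Matrix.mul_assoc, Matrix.mul_assoc U,
      rectDiagonal_mul_rectDiagonal_eq_ite]
    simp
  conv_lhs => rw [ht]; arg 1; rw [hM]
  rw [← Matrix.sub_mul, ← Matrix.mul_sub]
  congr 2
  ext i j
  simp only [rectDiagonal, Matrix.sub_apply, Matrix.of_apply]
  split_ifs <;> simp

theorem IsSVD.isTruncatedSVD (hm : r ≤ m) (hn : r ≤ n)
    {M : Matrix (Fin m) (Fin n) ℝ} {U : Matrix (Fin m) (Fin m) ℝ} {V : Matrix (Fin n) (Fin n) ℝ}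
    (h : IsSVD M U V) (hpos : 0 < singularValue M r) :
    IsTruncatedSVD M (firstCols hm U) (firstCols hn V) (fun j => singularValue M ((j : ℕ) + 1))
      (singularValue M r) (singularValue M (r + 1)) := by
  have hU := transpose_mul_self_of_mem_orthogonalGroup h.1
  have hV := transpose_mul_self_of_mem_orthogonalGroup h.2.1
  have hM : M = U * rectDiagonal m n (fun i => singularValue M (i + 1)) * Vᵀ := h.2.2
  have hMt : Mᵀ = V * rectDiagonal n m (fun i => singularValue M (i + 1)) * Uᵀ := by
    conv_lhs => rw [hM]
    simp only [Matrix.transpose_mul, transpose_rectDiagonal, Matrix.transpose_transpose,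
      Matrix.mul_assoc]
  refine ⟨firstCols_transpose_mul_self hm h.1, firstCols_transpose_mul_self hn h.2.1, ?_, ?_,
    hpos, fun j => singularValue_antitone M j.2, ?_⟩
  · conv_lhs => rw [hM]
    rw [firstCols_eq, firstCols_eq, ← rectDiagonal_self (fun j => singularValue M (j + 1)),
      Matrix.mul_assoc, ← Matrix.mul_assoc Vᵀ, hV, Matrix.one_mul, Matrix.mul_assoc,
      Matrix.mul_assoc, rectDiagonal_mul_rectDiagonal _ _ (Or.inr hn),
      rectDiagonal_mul_rectDiagonal _ _ (Or.inr le_rfl)]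
    simp
  · rw [hMt, firstCols_eq, firstCols_eq, ← rectDiagonal_self (fun j => singularValue M (j + 1)),
      Matrix.mul_assoc, ← Matrix.mul_assoc Uᵀ, hU, Matrix.one_mul, Matrix.mul_assoc,
      Matrix.mul_assoc, rectDiagonal_mul_rectDiagonal _ _ (Or.inr hm),
      rectDiagonal_mul_rectDiagonal _ _ (Or.inr le_rfl)]
    simp
  · refine (congrArg _ (residual_eq (hm := hm) (hn := hn) h)).trans_le ?_
    refine (l2_opNorm_mul _ _).trans ?_
    rw [norm_transpose_eq]
    refine (mul_le_of_le_one_right (norm_nonneg _) (norm_le_one_of_transpose_mul_self hV)).trans ?_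
    refine (l2_opNorm_mul _ _).trans ?_
    refine (mul_le_of_le_one_left (norm_nonneg _) (norm_le_one_of_transpose_mul_self hU)).trans ?_
    refine norm_rectDiagonal_le (singularValue_nonneg _ _) fun i _ _ => ?_
    split_ifs with hi
    · simpa using singularValue_nonneg M (r + 1)
    · rw [abs_of_nonneg (singularValue_nonneg _ _)]
      exact singularValue_antitone M (by omega)

/-- `σ_{r+1}` is a diagonal entry of the residual rotated by `U` and `V`; positivity guarantees that
this position exists. It yields `1 ≤ θ`. -/
theorem IsSVD.singularValue_le_frobeniusNorm {hm : r ≤ m} {hn : r ≤ n}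
    {M : Matrix (Fin m) (Fin n) ℝ} {U : Matrix (Fin m) (Fin m) ℝ} {V : Matrix (Fin n) (Fin n) ℝ}
    (h : IsSVD M U V) (hpos : 0 < singularValue M (r + 1)) :
    singularValue M (r + 1) ≤ frobeniusNorm (M - truncation hm hn M U V) := by
  have hU := transpose_mul_self_of_mem_orthogonalGroup h.1
  have hV := transpose_mul_self_of_mem_orthogonalGroup h.2.1
  obtain ⟨hm', hn'⟩ := lt_of_singularValue_pos hpos
  have h1 : Uᵀ * (M - truncation hm hn M U V) * V =
      rectDiagonal m n (fun i => if i < r then 0 else singularValue M (i + 1)) := by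
    rw [residual_eq h]
    calc _ = (Uᵀ * U) * rectDiagonal m n
          (fun i => if i < r then 0 else singularValue M (i + 1)) * (Vᵀ * V) := by
          simp only [Matrix.mul_assoc]
      _ = _ := by rw [hU, hV, Matrix.one_mul, Matrix.mul_one]
  have h2 := abs_entry_le_norm (Uᵀ * (M - truncation hm hn M U V) * V) ⟨r, hm'⟩ ⟨r, hn'⟩
  rw [h1] at h2
  have h3 : ‖Uᵀ * (M - truncation hm hn M U V) * V‖ ≤ ‖M - truncation hm hn M U V‖ := by
    refine (l2_opNorm_mul _ _).trans ?_
    refine (mul_le_of_le_one_right (norm_nonneg _) (norm_le_one_of_transpose_mul_self hV)).trans ?_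
    refine (l2_opNorm_mul _ _).trans ?_
    rw [norm_transpose_eq]
    exact mul_le_of_le_one_left (norm_nonneg _) (norm_le_one_of_transpose_mul_self hU)
  rw [← h1] at h2
  have h4 : singularValue M (r + 1) ≤ ‖M - truncation hm hn M U V‖ := by
    refine le_trans ?_ (h2.trans h3)
    simp [h1, rectDiagonal, abs_of_pos hpos]
  refine le_of_sq_le_sq ?_ (frobeniusNorm_nonneg _)
  rw [frobeniusNorm_sq]
  exact (pow_le_pow_left₀ hpos.le h4 2).trans (norm_sq_le_froSq _)

end SingularValueDecomposition

/-! ### Union bound over the adaptive iteration. -/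

section Iteration

/-- A two-stage union bound: on `bad` the second stage is bounded by `1`, elsewhere by `b`. As `f`
may depend on the first outcome, it covers adaptive choices. -/
theorem toOuterMeasure_bind_le {α β : Type*} (p : PMF α) (f : α → PMF β) {S : Set β} {bad : Set α}
    {a b : ENNReal} (ha : p.toOuterMeasure bad ≤ a)
    (hb : ∀ x ∉ bad, (f x).toOuterMeasure S ≤ b) : (p.bind f).toOuterMeasure S ≤ a + b := by
  have hone (x : α) : (f x).toOuterMeasure S ≤ 1 :=
    (MeasureTheory.measure_mono (Set.subset_univ S)).trans
      (((f x).toOuterMeasure_apply_eq_one_iff _).2 (Set.subset_univ _)).le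
  rw [PMF.toOuterMeasure_bind_apply]
  calc ∑' x, p x * (f x).toOuterMeasure S ≤ ∑' x, (bad.indicator p x + p x * b) := by
        refine ENNReal.tsum_le_tsum fun x => ?_
        by_cases hx : x ∈ bad
        · rw [Set.indicator_of_mem hx]
          exact (mul_le_of_le_one_right' (hone x)).trans le_self_add
        · rw [Set.indicator_of_notMem hx, zero_add]
          exact mul_le_mul_right (hb x hx) _
    _ = p.toOuterMeasure bad + b := by
        rw [ENNReal.tsum_add, ENNReal.tsum_mul_right, p.tsum_coe, one_mul,
          PMF.toOuterMeasure_apply]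
    _ ≤ a + b := by gcongr

variable {m n r : ℕ}

/-- Each half-step replaces the radius `δ` by `max (0.87 * δ) (4 * θ * ε)`: keeping it above the
floor makes the next half-step applicable. Each costs probability `ξ`, whatever the history. -/
theorem IsOutputLaw.toOuterMeasure_le {hm : r ≤ m} {hn : r ≤ n} (hr : 0 < r)
    {M : Matrix (Fin m) (Fin n) ℝ}
    {P : Matrix (Fin m) (Fin r) ℝ} {P' : Matrix (Fin n) (Fin r) ℝ} {s : Fin r → ℝ} {σ σ' θ : ℝ}
    (h : IsTruncatedSVD M P P' s σ σ') (hσ' : 0 < σ') (hσσ' : σ' ≤ σ / 2) (hθ : 1 ≤ θ)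
    (hK : froSq (M - P * Matrix.diagonal s * P'ᵀ) = (θ * σ') ^ 2)
    {ε ξ : ℝ} (hε : 0 < ε) (hεθ : 8 * θ * ε ≤ 1) (hξ0 : 0 < ξ) (hξ1 : ξ ≤ 1)
    {k : ℕ} {A : Matrix (Fin m) (Fin r) ℝ} {μ : PMF (Matrix (Fin m) (Fin r) ℝ)}
    (hμ : IsOutputLaw hm hn M ε ξ k A μ) {δ : ℝ} (hδ : δ ≤ 1 / 2) (hδε : 4 * θ * ε ≤ δ)
    (hdist : principalAngleDist (colSpan A) (colSpan P) ≤ δ) :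
    μ.toOuterMeasure {A' | ¬ principalAngleDist (colSpan A') (colSpan P) ≤
      max (0.87 ^ (2 * k) * δ) (4 * θ * ε)} ≤ ENNReal.ofReal (2 * k * ξ) := by
  have hKt : froSq (Mᵀ - P' * Matrix.diagonal s * Pᵀ) = (θ * σ') ^ 2 := by
    rw [← hK, ← froSq_transpose]
    simp [Matrix.transpose_mul, Matrix.mul_assoc]
  induction hμ generalizing δ with
  | zero A =>
    refine le_of_eq_of_le ?_ zero_le
    rw [PMF.toOuterMeasure_pure_apply, if_neg]
    simp [hdist]
  | succ k A γ β p hγ hp γ' β' q hγ' hq ν hν ih =>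
    have hδ0 : 0 < δ := lt_of_lt_of_le (by positivity) hδε
    obtain ⟨δ₁, hδ₁⟩ : ∃ δ₁, δ₁ = max (0.87 * δ) (4 * θ * ε) := ⟨_, rfl⟩
    have h₁ : δ₁ ≤ 1 / 2 := hδ₁ ▸ max_le (by linarith) (by linarith)
    have h₁ε : 4 * θ * ε ≤ δ₁ := hδ₁ ▸ le_max_right _ _
    have h₁δ : 0.87 * δ ≤ δ₁ := hδ₁ ▸ le_max_left _ _
    obtain ⟨δ₂, hδ₂⟩ : ∃ δ₂, δ₂ = max (0.87 * δ₁) (4 * θ * ε) := ⟨_, rfl⟩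
    have h₂ : δ₂ ≤ 1 / 2 := hδ₂ ▸ max_le (by linarith) (by linarith)
    have h₂ε : 4 * θ * ε ≤ δ₂ := hδ₂ ▸ le_max_right _ _
    have h₂δ : 0.87 * δ₁ ≤ δ₂ := hδ₂ ▸ le_max_left _ _
    have hpow : (0.87 : ℝ) ^ (2 * k) ≤ 1 := pow_le_one₀ (by norm_num) (by norm_num)
    -- The floor absorbs its own shrunken copies, so nested maxima collapse to a single one.
    have hfinal : max (0.87 ^ (2 * k) * δ₂) (4 * θ * ε) ≤
        max (0.87 ^ (2 * (k + 1)) * δ) (4 * θ * ε) := by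
      have hδ₂le : δ₂ ≤ max (0.87 ^ 2 * δ) (4 * θ * ε) := by
        rw [hδ₂, hδ₁, mul_max_of_nonneg _ _ (by norm_num)]
        refine max_le (max_le (le_max_of_le_left (by linarith)) (le_max_of_le_right ?_))
          (le_max_right _ _)
        have : 0 < 4 * θ * ε := by positivity
        linarith
      refine max_le ((mul_le_mul_of_nonneg_left hδ₂le (by positivity)).trans ?_) (le_max_right _ _)
      rw [mul_max_of_nonneg _ _ (by positivity), mul_add, pow_add, mul_one]
      exact max_le_max (mul_assoc _ _ _).ge (mul_le_of_le_one_left (by positivity) hpow)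
    have hsum : ENNReal.ofReal (2 * ((k + 1 : ℕ) : ℝ) * ξ) =
        ENNReal.ofReal ξ + (ENNReal.ofReal ξ + ENNReal.ofReal (2 * k * ξ)) := by
      rw [← ENNReal.ofReal_add hξ0.le (by positivity), ← ENNReal.ofReal_add hξ0.le (by positivity)]
      congr 1
      push_cast
      ring
    rw [hsum]
    obtain ⟨Q, R, hQ, rfl, hγQ⟩ := hγ.exists_factorization
    refine toOuterMeasure_bind_le _ _ (toOuterMeasure_updateB_le hr h hσ' hσσ' hθ hK hε hεθ hξ0
      hξ1 hQ hγQ hp hδ hδε hdist) fun ω hω => ?_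
    have hdist₁ := (not_not.1 hω).trans h₁δ
    obtain ⟨Q', R', hQ', hB, hγQ'⟩ := (hγ' ω).exists_factorization
    rw [hB] at hdist₁
    refine toOuterMeasure_bind_le _ _ (toOuterMeasure_updateB_le hr h.transpose hσ' hσσ' hθ hKt hε
      hεθ hξ0 hξ1 hQ' hγQ' (hq ω) h₁ h₁ε hdist₁) fun ω' hω' => ?_
    have hdist₂ := (not_not.1 hω').trans h₂δ
    rw [← hB, ← transpose_updateA, Matrix.transpose_transpose] at hdist₂
    exact (MeasureTheory.measure_mono fun A' (hA' : ¬ _) hle => hA' (le_trans hle hfinal)).trans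
      (ih ω ω' h₂ h₂ε hdist₂)

/-- Since `b < 1`, rounding the exponent up only decreases the power. The factor `2` counts the
half-steps and cancels the `1 / 2`. -/
theorem pow_two_mul_ceil_logb_le {b y : ℝ} (hb0 : 0 < b) (hb1 : b < 1) (hy : 0 < y) :
    b ^ (2 * ⌈(1 / 2 : ℝ) * Real.logb b y⌉₊) ≤ y := by
  have h := Nat.le_ceil ((1 / 2 : ℝ) * Real.logb b y)
  calc b ^ (2 * ⌈(1 / 2 : ℝ) * Real.logb b y⌉₊)
      = b ^ (((2 * ⌈(1 / 2 : ℝ) * Real.logb b y⌉₊ : ℕ) : ℝ)) := (Real.rpow_natCast _ _).symm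
    _ ≤ b ^ Real.logb b y := by
        refine Real.rpow_le_rpow_of_exponent_ge hb0 hb1.le ?_
        push_cast
        linarith
    _ = y := Real.rpow_logb hb0 hb1.ne hy

end Iteration

end LeverageRefinement

/-! ### The main theorem. -/

theorem mainTheorem2 {m n r : ℕ} (hr : 1 ≤ r) (hm : r ≤ m) (hn : r ≤ n)
    (M : Matrix (Fin m) (Fin n) ℝ)
    (U : Matrix (Fin m) (Fin m) ℝ) (V : Matrix (Fin n) (Fin n) ℝ)
    (hSVD : LeverageRefinement.IsSVD M U V)
    (hpos : 0 < LeverageRefinement.singularValue M (r + 1))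
    (hgap : LeverageRefinement.singularValue M (r + 1) < LeverageRefinement.singularValue M r)
    (hratio : LeverageRefinement.singularValue M (r + 1) /
      LeverageRefinement.singularValue M r ≤ 1 / 2)
    (θ : ℝ)
    (hθ : LeverageRefinement.frobeniusNorm (M - LeverageRefinement.truncation hm hn M U V) /
      LeverageRefinement.singularValue M (r + 1) = θ)
    (A₀ : Matrix (Fin m) (Fin r) ℝ)
    (hA₀ : LeverageRefinement.principalAngleDist (LeverageRefinement.colSpan A₀)
      (LeverageRefinement.colSpan (LeverageRefinement.firstCols hm U)) ≤ 1 / 2)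
    (ξ ε : ℝ) (hξ₀ : 0 < ξ) (hξ₁ : ξ < 1) (hε₀ : 0 < ε) (hε₁ : ε ≤ 1 / (8 * θ))
    (τ : ℕ) (hτ : τ = ⌈(1 / 2 : ℝ) * Real.logb 0.87 (8 * θ * ε)⌉₊)
    (μ : PMF (Matrix (Fin m) (Fin r) ℝ))
    (hμ : LeverageRefinement.IsOutputLaw hm hn M ε ξ τ A₀ μ) :
    ENNReal.ofReal (1 - 2 * (τ : ℝ) * ξ) ≤
      μ.toOuterMeasure {A | LeverageRefinement.principalAngleDist (LeverageRefinement.colSpan A)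
        (LeverageRefinement.colSpan (LeverageRefinement.firstCols hm U)) ≤ 4 * θ * ε} := by

  open LeverageRefinement in
  have hσr : 0 < singularValue M r := hpos.trans hgap
  have hσσ' : singularValue M (r + 1) ≤ singularValue M r / 2 := by
    rw [div_le_iff₀ hσr] at hratio
    linarith
  have hθ1 : 1 ≤ θ := by
    rw [← hθ, one_le_div hpos]
    exact hSVD.singularValue_le_frobeniusNorm hpos
  have hεθ : 8 * θ * ε ≤ 1 := by
    rw [le_div_iff₀ (by positivity)] at hε₁
    linarith
  have hK : froSq (M - truncation hm hn M U V) = (θ * singularValue M (r + 1)) ^ 2 := by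
    rw [← frobeniusNorm_sq, ← hθ, div_mul_cancel₀ _ hpos.ne']
  have hbad := hμ.toOuterMeasure_le hr (hSVD.isTruncatedSVD hm hn hσr) hpos hσσ' hθ1 hK hε₀ hεθ
    hξ₀ hξ₁.le le_rfl (by linarith) hA₀
  have hpow : (0.87 : ℝ) ^ (2 * τ) ≤ 8 * θ * ε :=
    hτ ▸ pow_two_mul_ceil_logb_le (by norm_num) (by norm_num) (by positivity)
  -- Starting from radius `1/2`, the geometric term is at most `8 * θ * ε / 2`, which is the floor.
  rw [max_eq_right (by linarith)] at hbad
  -- Truncated subtraction makes the claim equivalent to `1` being at most the probability of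
  -- success plus `2 * τ * ξ`, also when `2 * τ * ξ > 1`.
  rw [ENNReal.ofReal_sub _ (by positivity), ENNReal.ofReal_one, tsub_le_iff_right]
  have huniv : μ.toOuterMeasure Set.univ = 1 :=
    (μ.toOuterMeasure_apply_eq_one_iff _).2 (Set.subset_univ _)
  rw [← huniv, ← Set.union_compl_self {A | principalAngleDist (colSpan A)
    (colSpan (firstCols hm U)) ≤ 4 * θ * ε}]
  exact (MeasureTheory.measure_union_le _ _).trans (add_le_add le_rfl hbad)
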